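/- Consider the plane motion of a rigid body in an unbounded ideal incompressible fluid of density $\rho>0$. The body (mass $M>0$, central moment of inertia $I>0$) carries a particle of mass $m>0$ and a homogeneous circular rotor (mass $m_r>0$, central moment of inertia $I_r>0$) that turns about its center with angular velocity $\Omega(t)$ relative to the body. Attach to the body a moving frame whose origin is the center of mass of the body–rotor system; in it the centers of mass of the body and of the rotor are $(\xi_b,\eta_b)$ and $(\xi_r,\eta_r)$, so that $M\xi_b+m_r\xi_r=0$, $M\eta_b+m_r\eta_r=0$, and the particle is at $(\xi(t),\eta(t))$. Let $(x,y)$ be the position of the origin of the moving frame and $\alpha$ its angle of rotation in a fixed frame, $(v_1,v_2)$ the absolute velocity of that origin referred to the moving axes, and $\omega$ the angular velocity of the body: $$\dot x=v_1\cos\alpha-v_2\sin\alpha,\qquad \dot y=v_1\sin\alpha+v_2\cos\alpha,\qquad \dot\alpha=\omega .$$ The kinetic energy of body, particle, rotor and fluid is $$\begin{aligned}T={}&\tfrac12M\big((v_1-\eta_b\omega)^2+(v_2+\xi_b\omega)^2\big)+\tfrac12I\omega^2+\tfrac12m\big((v_1+\dot\xi-\eta\omega)^2+(v_2+\dot\eta+\xi\omega)^2\big)\\&+\tfrac12m_r\big((v_1-\eta_r\omega)^2+(v_2+\xi_r\omega)^2\big)+\tfrac12I_r(\omega+\Omega)^2+\tfrac12\big(\lambda_1v_1^2+\lambda_2v_2^2+\lambda_6\omega^2\big),\end{aligned}$$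 with added masses $\lambda_1,\lambda_2\ge0$, $\lambda_1\ne\lambda_2$ (the body is hydrodynamically asymmetric) and added moment of inertia $\lambda_6\ge0$. With the constant circulation $\Gamma\in\mathbb R$ around the body (possibly $\Gamma=0$), asymmetry coefficients $\mu,\nu\in\mathbb R$, and $\lambda=\rho\Gamma$, $\zeta=\rho\Gamma\mu$, $\chi=\rho\Gamma\nu$, the equations of motion are $$\begin{aligned}\frac{d}{dt}\frac{\partial T}{\partial v_1}&=\omega\frac{\partial T}{\partial v_2}-\lambda v_2-\zeta\omega,\\ \frac{d}{dt}\frac{\partial T}{\partial v_2}&=-\omega\frac{\partial T}{\partial v_1}+\lambda v_1+\chi\omega,\\ \frac{d}{dt}\frac{\partial T}{\partial \omega}&=v_2\frac{\partial T}{\partial v_1}-v_1\frac{\partial T}{\partial v_2}+\zeta v_1-\chi v_2 .\end{aligned}$$ **Theorem.** Let the particle move back and forth along a straight segment in the body, $\xi=k_1\sin s$, $\eta=k_2\sin s$, where the constants $k_1,k_2$ do not vanish simultaneously. Then, for every value of the circulation (zero or not), for every initial position $(x_0,y_0,\alpha_0)$ and initial velocity $(v_1^0,v_2^0,\omega^0)$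 of the body, every initial parameter $s_0$ and rate $\dot s_0$ of the particle, every initial angular velocity $\Omega_0$ of the rotor, every final position $(x_1,y_1,\alpha_1)$ of the body and every final parameter $s_1$ of the particle, there are a time $\mathcal T>0$ and smooth ($C^\infty$) controls $s(t)$, $\Omega(t)$ with $s(0)=s_0$, $\dot s(0)=\dot s_0$, $\Omega(0)=\Omega_0$, $s(\mathcal T)=s_1$, and a corresponding motion of the body on $[0,\mathcal T]$ with the given initial position and velocity such that $(x,y,\alpha)(\mathcal T)=(x_1,y_1,\alpha_1)$. -/

import Mathlib

open Set

noncomputable section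

/-- A plane rigid body in an unbounded ideal incompressible fluid, carrying an internal point mass
and a homogeneous internal rotor, together with the (constant) circulation of the fluid around it.
Lengths and velocities with indices `ξ`, `η` (or `1`, `2`) refer to a frame attached to the body
whose origin is the common center of mass of the body and the rotor. -/
structure FluidBody where
  /-- mass of the body -/
  M : ℝ
  /-- mass of the internal particle -/
  m : ℝ
  /-- mass of the rotor -/
  mr : ℝ
  /-- central moment of inertia of the body -/
  I : ℝ
  /-- central moment of inertia of the rotor -/
  Ir : ℝ
  /-- center of mass of the body -/
  ξb : ℝ
  ηb : ℝ
  /-- center of mass of the rotor -/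
  ξr : ℝ
  ηr : ℝ
  /-- added masses and added moment of inertia -/
  lam1 : ℝ
  lam2 : ℝ
  lam6 : ℝ
  /-- density of the fluid -/
  ρ : ℝ
  /-- circulation around the body; it may be zero -/
  Γ : ℝ
  /-- coefficients of the hydrodynamical asymmetry of the body -/
  μ : ℝ
  ν : ℝ
  M_pos : 0 < M
  m_pos : 0 < m
  mr_pos : 0 < mr
  I_pos : 0 < I
  Ir_pos : 0 < Ir
  /-- the origin of the moving frame is the center of mass of body and rotor -/
  center_ξ : M * ξb + mr * ξr = 0
  center_η : M * ηb + mr * ηr = 0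
  lam1_nonneg : 0 ≤ lam1
  lam2_nonneg : 0 ≤ lam2
  lam6_nonneg : 0 ≤ lam6
  /-- the body is hydrodynamically asymmetric -/
  lam_ne : lam1 ≠ lam2
  ρ_pos : 0 < ρ

namespace FluidBody

/-- `λ = ρ Γ` -/
def lam (B : FluidBody) : ℝ := B.ρ * B.Γ

/-- `ζ = ρ Γ μ` -/
def ζ (B : FluidBody) : ℝ := B.ρ * B.Γ * B.μ

/-- `χ = ρ Γ ν` -/
def χ (B : FluidBody) : ℝ := B.ρ * B.Γ * B.ν

/-- Kinetic energy of body, particle, rotor and fluid. Here `(ξ, η)` and `(dξ, dη)` are the position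
and the velocity of the particle in the moving frame, `Ω` is the angular velocity of the rotor
relative to the body, `(v₁, v₂)` is the absolute velocity of the origin of the moving frame,
referred to the axes of that frame, and `ω` is the angular velocity of the body. -/
def kineticEnergy (B : FluidBody) (ξ η dξ dη Ω v₁ v₂ ω : ℝ) : ℝ :=
  (1 / 2 * B.M * ((v₁ - B.ηb * ω) ^ 2 + (v₂ + B.ξb * ω) ^ 2) + 1 / 2 * B.I * ω ^ 2)
  + 1 / 2 * B.m * ((v₁ + dξ - η * ω) ^ 2 + (v₂ + dη + ξ * ω) ^ 2)
  + (1 / 2 * B.mr * ((v₁ - B.ηr * ω) ^ 2 + (v₂ + B.ξr * ω) ^ 2) + 1 / 2 * B.Ir * (ω + Ω) ^ 2)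
  + (1 / 2 * B.lam1 * v₁ ^ 2 + 1 / 2 * B.lam2 * v₂ ^ 2 + 1 / 2 * B.lam6 * ω ^ 2)

/-- `∂T/∂v₁` -/
def P₁ (B : FluidBody) (ξ η dξ dη Ω v₁ v₂ ω : ℝ) : ℝ :=
  deriv (fun v => B.kineticEnergy ξ η dξ dη Ω v v₂ ω) v₁

/-- `∂T/∂v₂` -/
def P₂ (B : FluidBody) (ξ η dξ dη Ω v₁ v₂ ω : ℝ) : ℝ :=
  deriv (fun v => B.kineticEnergy ξ η dξ dη Ω v₁ v ω) v₂

/-- `∂T/∂ω` -/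
def P₃ (B : FluidBody) (ξ η dξ dη Ω v₁ v₂ ω : ℝ) : ℝ :=
  deriv (fun w => B.kineticEnergy ξ η dξ dη Ω v₁ v₂ w) ω

/-- `(x, y, α, v₁, v₂, ω)` is a motion of the body on the time interval `[0, T]` under the controls
`ξ`, `η` (position of the particle in the body) and `Ω` (angular velocity of the rotor): the
kinematic relations and the equations of motion with the forces due to the circulation hold.
`(x, y)` is the position of the origin of the moving frame in the fixed frame, and `α` is (a
continuous choice of) the angle of rotation of the moving frame. -/
structure IsMotion (B : FluidBody) (T : ℝ) (ξ η Ω x y α v₁ v₂ ω : ℝ → ℝ) : Prop where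
  kin_x : ∀ t ∈ Icc 0 T,
    HasDerivWithinAt x (v₁ t * Real.cos (α t) - v₂ t * Real.sin (α t)) (Icc 0 T) t
  kin_y : ∀ t ∈ Icc 0 T,
    HasDerivWithinAt y (v₁ t * Real.sin (α t) + v₂ t * Real.cos (α t)) (Icc 0 T) t
  kin_α : ∀ t ∈ Icc 0 T, HasDerivWithinAt α (ω t) (Icc 0 T) t
  dyn₁ : ∀ t ∈ Icc 0 T,
    HasDerivWithinAt
      (fun τ => B.P₁ (ξ τ) (η τ) (deriv ξ τ) (deriv η τ) (Ω τ) (v₁ τ) (v₂ τ) (ω τ))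
      (ω t * B.P₂ (ξ t) (η t) (deriv ξ t) (deriv η t) (Ω t) (v₁ t) (v₂ t) (ω t)
        - B.lam * v₂ t - B.ζ * ω t) (Icc 0 T) t
  dyn₂ : ∀ t ∈ Icc 0 T,
    HasDerivWithinAt
      (fun τ => B.P₂ (ξ τ) (η τ) (deriv ξ τ) (deriv η τ) (Ω τ) (v₁ τ) (v₂ τ) (ω τ))
      (-(ω t) * B.P₁ (ξ t) (η t) (deriv ξ t) (deriv η t) (Ω t) (v₁ t) (v₂ t) (ω t)
        + B.lam * v₁ t + B.χ * ω t) (Icc 0 T) t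
  dyn₃ : ∀ t ∈ Icc 0 T,
    HasDerivWithinAt
      (fun τ => B.P₃ (ξ τ) (η τ) (deriv ξ τ) (deriv η τ) (Ω τ) (v₁ τ) (v₂ τ) (ω τ))
      (v₂ t * B.P₁ (ξ t) (η t) (deriv ξ t) (deriv η t) (Ω t) (v₁ t) (v₂ t) (ω t)
        - v₁ t * B.P₂ (ξ t) (η t) (deriv ξ t) (deriv η t) (Ω t) (v₁ t) (v₂ t) (ω t)
        + B.ζ * v₁ t - B.χ * v₂ t) (Icc 0 T) t

end FluidBody

end

-- The rotor enters the equations only through the term `Ir * Ω` in `∂T/∂ω`, so the third equation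
-- can be solved for `Ω` after any smooth angle `α(t)` has been prescribed. Thus `α` becomes a
-- control, next to the displacement `u = sin s` of the particle (`exists_isMotion`). The two
-- momentum equations integrate once: the circulation forces are exact derivatives, and the
-- constants `K₁`, `K₂` encode the initial velocity. What remains is a first-order system, linear in
-- `(x, y)`, with the controls `α` and `u`; it has global solutions.
--
-- Zero circulation (`controllable_of_lam_eq_zero`). Up to a bounded drift and a boundary term, the
-- displacement is `1 / a₁ - 1 / a₂` times an invertible linear image of the integrals of `u cos α
-- dα` and `u sin α dα`. This is where hydrodynamical asymmetry matters. Taking `u = c₁ cos α + c₂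
-- sin α` over `N` turns yields `π N c₁` and `π N c₂`. All turns are made in a fixed time, so the
-- drift is bounded independently of `N`, and a large `N` reaches any target with small `c₁`, `c₂`.
--
-- Nonzero circulation (`controllable_of_lam_ne_zero`). Once the body has its final angle, the
-- translational motion is a harmonic oscillator forced by the particle. Without forcing its energy
-- is conserved, so the position stays in a bounded set however long one waits. The correction
-- needed is therefore bounded independently of the waiting time, and a slowly modulated small force
-- produces it (`exists_oscillator_control`, `IsPath.superpose`).

local notation "∞" => ((⊤ : ℕ∞) : WithTop ℕ∞)

/-! ### Global smooth solutions of linear differential equations -/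

open scoped BoundedContinuousFunction in
/-- Global existence for linear ordinary differential equations with continuous coefficients. -/
theorem exists_forall_hasDerivAt_linear {E : Type*} [NormedAddCommGroup E] [NormedSpace ℝ E]
    [CompleteSpace E] {A : ℝ → E →L[ℝ] E} {b : ℝ → E} (hA : Continuous A) (hb : Continuous b)
    (x₀ : E) : ∃ z : ℝ → E, z 0 = x₀ ∧ ∀ t, HasDerivAt z (A t (z t) + b t) t := by
  set M : ℝ → ℝ := fun t => ‖A t‖ + ‖b t‖ with hM
  have hMc : Continuous M := by fun_prop
  set N : ℝ → ℝ := fun t => 2 * ∫ τ in (0 : ℝ)..t, M τ with hN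
  have hNd : ∀ t, HasDerivAt N (2 * M t) t := fun t =>
    (intervalIntegral.integral_hasDerivAt_right (hMc.intervalIntegrable _ _)
      (hMc.stronglyMeasurableAtFilter _ _) hMc.continuousAt).const_mul 2
  have hNc : Continuous N := continuous_iff_continuousAt.2 fun t => (hNd t).continuousAt
  -- The weight of the norm in which Picard iteration contracts. Since `sinh N` has derivative `2 M
  -- W` and `|sinh| ≤ cosh`, a single smooth weight serves positive and negative times; the factor 2
  -- in `N` becomes the contraction constant `1 / 2`.
  set W : ℝ → ℝ := fun t => Real.cosh (N t) with hW
  have hWc : Continuous W := Real.continuous_cosh.comp hNc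
  have hW1 : ∀ t, 1 ≤ W t := fun t => Real.one_le_cosh _
  have hW0 : ∀ t, 0 < W t := fun t => Real.cosh_pos _
  have key : ∀ (f : ℝ → E) (C : ℝ), 0 ≤ C → (∀ τ, ‖f τ‖ ≤ M τ * C * W τ) → ∀ t,
      ‖∫ τ in (0 : ℝ)..t, f τ‖ ≤ C / 2 * W t := by
    intro f C hC hf t
    have hcont : Continuous fun τ => M τ * C * W τ := by fun_prop
    have h1 : ‖∫ τ in (0 : ℝ)..t, f τ‖ ≤ |∫ τ in (0 : ℝ)..t, M τ * C * W τ| :=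
      intervalIntegral.norm_integral_le_abs_of_norm_le (Filter.Eventually.of_forall fun τ => hf τ)
        (hcont.intervalIntegrable _ _)
    have h2 : ∫ τ in (0 : ℝ)..t, M τ * C * W τ = C / 2 * Real.sinh (N t) := by
      rw [intervalIntegral.integral_eq_sub_of_hasDerivAt (f := fun τ => C / 2 * Real.sinh (N τ))
        (fun τ _ => ?_) (hcont.intervalIntegrable _ _)]
      · simp [hN]
      · exact (((hNd τ).sinh).const_mul (C / 2)).congr_deriv (by simp only [hW]; ring)
    rw [h2, abs_mul, abs_of_nonneg (by positivity : 0 ≤ C / 2)] at h1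
    refine h1.trans (mul_le_mul_of_nonneg_left ?_ (by positivity))
    rw [Real.abs_sinh]
    exact (Real.sinh_lt_cosh _).le.trans (Real.cosh_abs _).le
  have hint : ∀ g : ℝ →ᵇ E, Continuous fun τ => A τ (W τ • g τ) + b τ := fun g =>
    (hA.clm_apply (hWc.smul g.continuous)).add hb
  have hbound : ∀ (g : ℝ →ᵇ E) t,
      ‖(W t)⁻¹ • (x₀ + ∫ τ in (0 : ℝ)..t, (A τ (W τ • g τ) + b τ))‖ ≤ ‖x₀‖ + (‖g‖ + 1) / 2 := by
    intro g t
    have h := key (fun τ => A τ (W τ • g τ) + b τ) (‖g‖ + 1) (by positivity) (fun τ => ?_) t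
    · rw [norm_smul, norm_inv, Real.norm_of_nonneg (hW0 t).le, inv_mul_le_iff₀ (hW0 t)]
      refine (norm_add_le _ _).trans ?_
      nlinarith [norm_nonneg x₀, hW1 t]
    · have h1 : ‖A τ (W τ • g τ)‖ ≤ ‖A τ‖ * (W τ * ‖g‖) := by
        refine (ContinuousLinearMap.le_opNorm _ _).trans ?_
        rw [norm_smul, Real.norm_of_nonneg (hW0 τ).le]
        gcongr
        exact g.norm_coe_le_norm τ
      refine (norm_add_le _ _).trans ?_
      have h2 : ‖b τ‖ ≤ ‖b τ‖ * W τ := le_mul_of_one_le_right (norm_nonneg _) (hW1 τ)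
      have h3 : 0 ≤ ‖b τ‖ * (W τ * ‖g‖) := mul_nonneg (norm_nonneg _) (mul_nonneg (hW0 τ).le (norm_nonneg _))
      have h4 : 0 ≤ ‖A τ‖ * W τ := mul_nonneg (norm_nonneg _) (hW0 τ).le
      simp only [hM]
      nlinarith
  -- The unknown is `g = z / W`, which is bounded even when the solution `z` is not.
  set Φ : (ℝ →ᵇ E) → (ℝ →ᵇ E) := fun g => BoundedContinuousFunction.ofNormedAddCommGroup
    (fun t => (W t)⁻¹ • (x₀ + ∫ τ in (0 : ℝ)..t, (A τ (W τ • g τ) + b τ)))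
    ((hWc.inv₀ fun t => (hW0 t).ne').smul (continuous_const.add
      (intervalIntegral.continuous_primitive (fun _ _ => (hint g).intervalIntegrable _ _) 0)))
    _ (hbound g) with hΦ
  have hcontr : ContractingWith (1 / 2) Φ := by
    refine ⟨by norm_num, LipschitzWith.of_dist_le_mul fun g h => ?_⟩
    refine (BoundedContinuousFunction.dist_le (by positivity)).2 fun t => ?_
    have hk := key (fun τ => A τ (W τ • (g τ - h τ))) (dist g h) dist_nonneg (fun τ => ?_) t
    · rw [dist_eq_norm]
      have e : Φ g t - Φ h t = (W t)⁻¹ • ∫ τ in (0 : ℝ)..t, A τ (W τ • (g τ - h τ)) := by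
        change (W t)⁻¹ • (x₀ + ∫ τ in (0 : ℝ)..t, (A τ (W τ • g τ) + b τ))
          - (W t)⁻¹ • (x₀ + ∫ τ in (0 : ℝ)..t, (A τ (W τ • h τ) + b τ)) = _
        rw [← smul_sub, add_sub_add_left_eq_sub, ← intervalIntegral.integral_sub
          ((hint g).intervalIntegrable _ _) ((hint h).intervalIntegrable _ _)]
        congr 2
        ext τ
        rw [smul_sub, map_sub]; abel
      rw [e, norm_smul, norm_inv, Real.norm_of_nonneg (hW0 t).le, inv_mul_le_iff₀ (hW0 t)]
      refine hk.trans (le_of_eq ?_)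
      push_cast; ring
    · refine (ContinuousLinearMap.le_opNorm _ _).trans ?_
      rw [norm_smul, Real.norm_of_nonneg (hW0 τ).le]
      have h1 : ‖g τ - h τ‖ ≤ dist g h := by
        rw [← dist_eq_norm]; exact BoundedContinuousFunction.dist_coe_le_dist τ
      have h2 : ‖A τ‖ ≤ M τ := le_add_of_nonneg_right (norm_nonneg _)
      calc ‖A τ‖ * (W τ * ‖g τ - h τ‖) ≤ M τ * (W τ * dist g h) := by
            have := (hW0 τ).le
            gcongr
        _ = _ := by ring
  have hfix : Φ (ContractingWith.fixedPoint Φ hcontr) = ContractingWith.fixedPoint Φ hcontr :=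
    ContractingWith.fixedPoint_isFixedPt hcontr
  set g := ContractingWith.fixedPoint Φ hcontr
  have hz : ∀ t, W t • g t = x₀ + ∫ τ in (0 : ℝ)..t, (A τ (W τ • g τ) + b τ) := by
    intro t
    have : g t = (W t)⁻¹ • (x₀ + ∫ τ in (0 : ℝ)..t, (A τ (W τ • g τ) + b τ)) :=
      (DFunLike.congr_fun hfix t).symm
    conv_lhs => rw [this]
    rw [smul_inv_smul₀ (hW0 t).ne']
  refine ⟨fun t => W t • g t, (hz 0).trans (by simp), fun t => ?_⟩
  have hd := (intervalIntegral.integral_hasDerivAt_right ((hint g).intervalIntegrable 0 t)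
    ((hint g).stronglyMeasurableAtFilter _ _) (hint g).continuousAt).const_add x₀
  exact hd.congr_of_eventuallyEq (Filter.Eventually.of_forall hz)

/-- Bootstrapping: a `C^n` solution makes the right-hand side `C^n`, hence is itself `C^(n+1)`. -/
theorem contDiff_of_hasDerivAt_linear {E : Type*} [NormedAddCommGroup E] [NormedSpace ℝ E]
    {A : ℝ → E →L[ℝ] E} {b z : ℝ → E}
    (hA : ContDiff ℝ ∞ A) (hb : ContDiff ℝ ∞ b)
    (hz : ∀ t, HasDerivAt z (A t (z t) + b t) t) : ContDiff ℝ ∞ z := by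
  rw [contDiff_infty]
  intro n
  induction n with
  | zero =>
    exact contDiff_zero.2 (continuous_iff_continuousAt.2 fun t => (hz t).continuousAt)
  | succ n ih =>
    have hd : deriv z = fun t => A t (z t) + b t := funext fun t => (hz t).deriv
    have : ContDiff ℝ ((n : WithTop ℕ∞) + 1) z := by
      rw [contDiff_succ_iff_deriv]
      refine ⟨fun t => (hz t).differentiableAt, by simp, ?_⟩
      rw [hd]
      exact ((contDiff_infty.1 hA n).clm_apply ih).add (contDiff_infty.1 hb n)
    exact_mod_cast this

/-- Global smooth solutions of planar linear systems with smooth coefficients. -/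
theorem exists_contDiff_planar_linear {a₁₁ a₁₂ a₂₁ a₂₂ b₁ b₂ : ℝ → ℝ}
    (h₁₁ : ContDiff ℝ ∞ a₁₁) (h₁₂ : ContDiff ℝ ∞ a₁₂)
    (h₂₁ : ContDiff ℝ ∞ a₂₁) (h₂₂ : ContDiff ℝ ∞ a₂₂)
    (hb₁ : ContDiff ℝ ∞ b₁) (hb₂ : ContDiff ℝ ∞ b₂)
    (x₀ y₀ : ℝ) : ∃ x y : ℝ → ℝ, ContDiff ℝ ∞ x ∧
      ContDiff ℝ ∞ y ∧ x 0 = x₀ ∧ y 0 = y₀ ∧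
      (∀ t, HasDerivAt x (a₁₁ t * x t + a₁₂ t * y t + b₁ t) t) ∧
      ∀ t, HasDerivAt y (a₂₁ t * x t + a₂₂ t * y t + b₂ t) t := by
  let p := ContinuousLinearMap.fst ℝ ℝ ℝ
  let q := ContinuousLinearMap.snd ℝ ℝ ℝ
  let i := ContinuousLinearMap.inl ℝ ℝ ℝ
  let j := ContinuousLinearMap.inr ℝ ℝ ℝ
  let A : ℝ → (ℝ × ℝ) →L[ℝ] (ℝ × ℝ) := fun t => a₁₁ t • i.comp p + a₁₂ t • i.comp q
    + a₂₁ t • j.comp p + a₂₂ t • j.comp q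
  let b : ℝ → ℝ × ℝ := fun t => (b₁ t, b₂ t)
  have hA : ContDiff ℝ ∞ A := by
    exact (((h₁₁.smul contDiff_const).add (h₁₂.smul contDiff_const)).add
      (h₂₁.smul contDiff_const)).add (h₂₂.smul contDiff_const)
  have hb : ContDiff ℝ ∞ b := hb₁.prodMk hb₂
  obtain ⟨z, hz0, hz⟩ := exists_forall_hasDerivAt_linear hA.continuous hb.continuous (x₀, y₀)
  have hzs := contDiff_of_hasDerivAt_linear hA hb hz
  refine ⟨fun t => (z t).1, fun t => (z t).2, contDiff_fst.comp hzs, contDiff_snd.comp hzs,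
    by simp [hz0], by simp [hz0], fun t => ?_, fun t => ?_⟩
  · exact (p.hasFDerivAt.comp_hasDerivAt t (hz t)).congr_deriv (by simp [A, b, p, q, i, j])
  · exact (q.hasFDerivAt.comp_hasDerivAt t (hz t)).congr_deriv (by simp [A, b, p, q, i, j])

/-! ### The planar model: translation with the angle as a control -/

/-- The translational dynamics of the body, integrated once with the help of the conservation of
the linear momentum; `K₁` and `K₂` are the constants of integration. -/
structure PlanarModel where
  a₁ : ℝ
  a₂ : ℝ
  κ₁ : ℝ
  κ₂ : ℝ
  lam : ℝ
  χ : ℝ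
  ζ : ℝ
  K₁ : ℝ
  K₂ : ℝ

namespace PlanarModel

/-- Components of the momentum in the moving frame, turned by the angle `θ`. -/
noncomputable def p₁ (R : PlanarModel) (θ x y : ℝ) : ℝ :=
  (R.K₁ - R.lam * y) * Real.cos θ + (R.K₂ + R.lam * x) * Real.sin θ + R.χ

noncomputable def p₂ (R : PlanarModel) (θ x y : ℝ) : ℝ :=
  -(R.K₁ - R.lam * y) * Real.sin θ + (R.K₂ + R.lam * x) * Real.cos θ + R.ζ

/-- Components of the velocity in the moving frame; `u` is the displacement of the particle and
`w` its rate. -/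
noncomputable def v₁ (R : PlanarModel) (θ ω u w x y : ℝ) : ℝ :=
  (R.p₁ θ x y + R.κ₂ * u * ω - R.κ₁ * w) / R.a₁

noncomputable def v₂ (R : PlanarModel) (θ ω u w x y : ℝ) : ℝ :=
  (R.p₂ θ x y - R.κ₁ * u * ω - R.κ₂ * w) / R.a₂

/-- `(x, y)` is a trajectory under the controls `θ` and `u`. -/
structure IsPath (R : PlanarModel) (θ u x y : ℝ → ℝ) : Prop where
  deriv_x : ∀ t, HasDerivAt x
    (R.v₁ (θ t) (deriv θ t) (u t) (deriv u t) (x t) (y t) * Real.cos (θ t)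
      - R.v₂ (θ t) (deriv θ t) (u t) (deriv u t) (x t) (y t) * Real.sin (θ t)) t
  deriv_y : ∀ t, HasDerivAt y
    (R.v₁ (θ t) (deriv θ t) (u t) (deriv u t) (x t) (y t) * Real.sin (θ t)
      + R.v₂ (θ t) (deriv θ t) (u t) (deriv u t) (x t) (y t) * Real.cos (θ t)) t

variable {R : PlanarModel} {θ u x y : ℝ → ℝ}

/-- This is the first equation of motion with `p₁` in the role of `∂T/∂v₁`. By the kinematic
relations, the position terms of `p₁` differentiate exactly to the circulation force, whatever `K₁`
and `K₂` are. -/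
theorem IsPath.hasDerivAt_p₁ (h : R.IsPath θ u x y) {t ω : ℝ} (hθ : HasDerivAt θ ω t) :
    HasDerivAt (fun τ => R.p₁ (θ τ) (x τ) (y τ))
      (ω * (R.p₂ (θ t) (x t) (y t) - R.ζ)
        - R.lam * R.v₂ (θ t) (deriv θ t) (u t) (deriv u t) (x t) (y t)) t := by
  have h1 := ((((h.deriv_y t).const_mul R.lam).const_sub R.K₁).mul hθ.cos).add
    ((((h.deriv_x t).const_mul R.lam).const_add R.K₂).mul hθ.sin)
  refine (h1.add_const R.χ).congr_deriv ?_
  simp only [p₂]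
  linear_combination (-R.lam * R.v₂ (θ t) (deriv θ t) (u t) (deriv u t) (x t) (y t))
    * Real.sin_sq_add_cos_sq (θ t)

theorem IsPath.hasDerivAt_p₂ (h : R.IsPath θ u x y) {t ω : ℝ} (hθ : HasDerivAt θ ω t) :
    HasDerivAt (fun τ => R.p₂ (θ τ) (x τ) (y τ))
      (-ω * (R.p₁ (θ t) (x t) (y t) - R.χ)
        + R.lam * R.v₁ (θ t) (deriv θ t) (u t) (deriv u t) (x t) (y t)) t := by
  have h1 := ((((h.deriv_y t).const_mul R.lam).const_sub R.K₁).neg.mul hθ.sin).add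
    ((((h.deriv_x t).const_mul R.lam).const_add R.K₂).mul hθ.cos)
  refine (h1.add_const R.ζ).congr_deriv ?_
  simp only [p₁, Pi.neg_apply]
  linear_combination (R.lam * R.v₁ (θ t) (deriv θ t) (u t) (deriv u t) (x t) (y t))
    * Real.sin_sq_add_cos_sq (θ t)

theorem contDiff_p₁ (R : PlanarModel) (hθ : ContDiff ℝ ∞ θ) (hx : ContDiff ℝ ∞ x)
    (hy : ContDiff ℝ ∞ y) : ContDiff ℝ ∞ fun t => R.p₁ (θ t) (x t) (y t) := by
  unfold p₁; fun_prop

theorem contDiff_p₂ (R : PlanarModel) (hθ : ContDiff ℝ ∞ θ) (hx : ContDiff ℝ ∞ x)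
    (hy : ContDiff ℝ ∞ y) : ContDiff ℝ ∞ fun t => R.p₂ (θ t) (x t) (y t) := by
  unfold p₂; fun_prop

theorem contDiff_v₁ (R : PlanarModel) {ω w : ℝ → ℝ} (hθ : ContDiff ℝ ∞ θ) (hω : ContDiff ℝ ∞ ω)
    (hu : ContDiff ℝ ∞ u) (hw : ContDiff ℝ ∞ w) (hx : ContDiff ℝ ∞ x) (hy : ContDiff ℝ ∞ y) :
    ContDiff ℝ ∞ fun t => R.v₁ (θ t) (ω t) (u t) (w t) (x t) (y t) := by
  have := R.contDiff_p₁ hθ hx hy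
  unfold v₁; fun_prop

theorem contDiff_v₂ (R : PlanarModel) {ω w : ℝ → ℝ} (hθ : ContDiff ℝ ∞ θ) (hω : ContDiff ℝ ∞ ω)
    (hu : ContDiff ℝ ∞ u) (hw : ContDiff ℝ ∞ w) (hx : ContDiff ℝ ∞ x) (hy : ContDiff ℝ ∞ y) :
    ContDiff ℝ ∞ fun t => R.v₂ (θ t) (ω t) (u t) (w t) (x t) (y t) := by
  have := R.contDiff_p₂ hθ hx hy
  unfold v₂; fun_prop

theorem contDiff_deriv {f : ℝ → ℝ} (hf : ContDiff ℝ ∞ f) : ContDiff ℝ ∞ (deriv f) :=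
  (contDiff_infty_iff_deriv.1 hf).2

/-- The velocities are affine in `(x, y)`, so the system is linear; its inhomogeneous part is the
velocity at `x = y = 0`. -/
theorem exists_isPath (R : PlanarModel) (hθ : ContDiff ℝ ∞ θ) (hu : ContDiff ℝ ∞ u) (x₀ y₀ : ℝ) :
    ∃ x y : ℝ → ℝ, ContDiff ℝ ∞ x ∧ ContDiff ℝ ∞ y ∧ x 0 = x₀ ∧ y 0 = y₀ ∧ R.IsPath θ u x y := by
  have hω := contDiff_deriv hθ
  have hw := contDiff_deriv hu
  obtain ⟨x, y, hx, hy, hx0, hy0, hdx, hdy⟩ := exists_contDiff_planar_linear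
    (a₁₁ := fun t => R.lam * Real.sin (θ t) * Real.cos (θ t) / R.a₁
      - R.lam * Real.cos (θ t) * Real.sin (θ t) / R.a₂)
    (a₁₂ := fun t => -R.lam * Real.cos (θ t) * Real.cos (θ t) / R.a₁
      - R.lam * Real.sin (θ t) * Real.sin (θ t) / R.a₂)
    (a₂₁ := fun t => R.lam * Real.sin (θ t) * Real.sin (θ t) / R.a₁
      + R.lam * Real.cos (θ t) * Real.cos (θ t) / R.a₂)
    (a₂₂ := fun t => -R.lam * Real.cos (θ t) * Real.sin (θ t) / R.a₁
      + R.lam * Real.sin (θ t) * Real.cos (θ t) / R.a₂)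
    (b₁ := fun t => R.v₁ (θ t) (deriv θ t) (u t) (deriv u t) 0 0 * Real.cos (θ t)
      - R.v₂ (θ t) (deriv θ t) (u t) (deriv u t) 0 0 * Real.sin (θ t))
    (b₂ := fun t => R.v₁ (θ t) (deriv θ t) (u t) (deriv u t) 0 0 * Real.sin (θ t)
      + R.v₂ (θ t) (deriv θ t) (u t) (deriv u t) 0 0 * Real.cos (θ t))
    (by fun_prop) (by fun_prop) (by fun_prop) (by fun_prop)
    (by
      have h1 := R.contDiff_v₁ hθ hω hu hw (contDiff_const (c := 0)) (contDiff_const (c := 0))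
      have h2 := R.contDiff_v₂ hθ hω hu hw (contDiff_const (c := 0)) (contDiff_const (c := 0))
      fun_prop)
    (by
      have h1 := R.contDiff_v₁ hθ hω hu hw (contDiff_const (c := 0)) (contDiff_const (c := 0))
      have h2 := R.contDiff_v₂ hθ hω hu hw (contDiff_const (c := 0)) (contDiff_const (c := 0))
      fun_prop) x₀ y₀
  refine ⟨x, y, hx, hy, hx0, hy0, fun t => (hdx t).congr_deriv ?_, fun t => (hdy t).congr_deriv ?_⟩
  · simp only [v₁, v₂, p₁, p₂]; ring
  · simp only [v₁, v₂, p₁, p₂]; ring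

end PlanarModel

/-! ### Reduction of the equations of motion to the planar model -/

noncomputable section

namespace FluidBody

theorem deriv_quadratic {f : ℝ → ℝ} (a b c : ℝ) (h : ∀ v, f v = a * v ^ 2 + b * v + c) (v : ℝ) :
    deriv f v = 2 * a * v + b := by
  have h1 : HasDerivAt (fun v : ℝ => a * v ^ 2 + b * v + c) (2 * a * v + b) v :=
    ((((hasDerivAt_pow 2 v).const_mul a).add ((hasDerivAt_id v).const_mul b)).add_const
      c).congr_deriv (by norm_num; ring)
  rw [funext h]
  exact h1.deriv

variable (B : FluidBody) (ξ η dξ dη Ω v₁ v₂ ω : ℝ)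

/-- The contributions of `ηb` and `ηr` cancel because the origin is the common center of mass. -/
theorem P₁_eq : B.P₁ ξ η dξ dη Ω v₁ v₂ ω
    = (B.M + B.mr + B.m + B.lam1) * v₁ - B.m * η * ω + B.m * dξ := by
  rw [P₁, deriv_quadratic ((B.M + B.mr + B.m + B.lam1) / 2) (-B.m * η * ω + B.m * dξ)
    (B.kineticEnergy ξ η dξ dη Ω 0 v₂ ω)]
  · ring
  · intro v
    simp only [kineticEnergy]
    linear_combination (-v * ω) * B.center_η

theorem P₂_eq : B.P₂ ξ η dξ dη Ω v₁ v₂ ω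
    = (B.M + B.mr + B.m + B.lam2) * v₂ + B.m * ξ * ω + B.m * dη := by
  rw [P₂, deriv_quadratic ((B.M + B.mr + B.m + B.lam2) / 2) (B.m * ξ * ω + B.m * dη)
    (B.kineticEnergy ξ η dξ dη Ω v₁ 0 ω)]
  · ring
  · intro v
    simp only [kineticEnergy]
    linear_combination (v * ω) * B.center_ξ

/-- The part of `∂T/∂ω` that does not depend on the rotor. -/
def angularMomentum : ℝ :=
  (B.I + B.Ir + B.lam6 + B.M * (B.ξb ^ 2 + B.ηb ^ 2) + B.mr * (B.ξr ^ 2 + B.ηr ^ 2)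
    + B.m * (ξ ^ 2 + η ^ 2)) * ω + B.m * (ξ * (v₂ + dη) - η * (v₁ + dξ))

theorem P₃_eq : B.P₃ ξ η dξ dη Ω v₁ v₂ ω
    = B.angularMomentum ξ η dξ dη v₁ v₂ ω + B.Ir * Ω := by
  rw [P₃, deriv_quadratic ((B.I + B.Ir + B.lam6 + B.M * (B.ξb ^ 2 + B.ηb ^ 2)
    + B.mr * (B.ξr ^ 2 + B.ηr ^ 2) + B.m * (ξ ^ 2 + η ^ 2)) / 2)
    (B.m * (ξ * (v₂ + dη) - η * (v₁ + dξ)) + B.Ir * Ω)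
    (B.kineticEnergy ξ η dξ dη Ω v₁ v₂ 0)]
  · simp only [angularMomentum]; ring
  · intro w
    simp only [kineticEnergy]
    linear_combination (v₂ * w) * B.center_ξ - (v₁ * w) * B.center_η

/-- The planar model of a body whose particle moves along a segment in the direction `(k₁, k₂)`. -/
noncomputable def planarModel (k₁ k₂ K₁ K₂ : ℝ) : PlanarModel where
  a₁ := B.M + B.mr + B.m + B.lam1
  a₂ := B.M + B.mr + B.m + B.lam2
  κ₁ := B.m * k₁
  κ₂ := B.m * k₂
  lam := B.lam
  χ := B.χ
  ζ := B.ζ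
  K₁ := K₁
  K₂ := K₂

theorem planarModel_a₁_pos (k₁ k₂ K₁ K₂ : ℝ) : 0 < (B.planarModel k₁ k₂ K₁ K₂).a₁ := by
  have := B.M_pos; have := B.mr_pos; have := B.m_pos; have := B.lam1_nonneg
  simp only [planarModel]; positivity

theorem planarModel_a₂_pos (k₁ k₂ K₁ K₂ : ℝ) : 0 < (B.planarModel k₁ k₂ K₁ K₂).a₂ := by
  have := B.M_pos; have := B.mr_pos; have := B.m_pos; have := B.lam2_nonneg
  simp only [planarModel]; positivity

/-- The constants of integration can be chosen so as to produce any given initial velocity. -/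
theorem exists_momentum_constants (k₁ k₂ θ₀ ω₀ u₀ w₀ x₀ y₀ v₁₀ v₂₀ : ℝ) : ∃ K₁ K₂ : ℝ,
    (B.planarModel k₁ k₂ K₁ K₂).v₁ θ₀ ω₀ u₀ w₀ x₀ y₀ = v₁₀ ∧
    (B.planarModel k₁ k₂ K₁ K₂).v₂ θ₀ ω₀ u₀ w₀ x₀ y₀ = v₂₀ := by
  have h1 := (B.planarModel_a₁_pos k₁ k₂ 0 0).ne'
  have h2 := (B.planarModel_a₂_pos k₁ k₂ 0 0).ne'
  simp only [planarModel] at h1 h2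
  -- The pair `(q₁, q₂)` is the prescribed initial momentum without `χ` and `ζ`. Turning it back to
  -- the fixed frame and removing the position terms gives `K₁`, `K₂`.
  set q₁ := (B.M + B.mr + B.m + B.lam1) * v₁₀ - B.m * k₂ * u₀ * ω₀ + B.m * k₁ * w₀ - B.χ with hq₁
  set q₂ := (B.M + B.mr + B.m + B.lam2) * v₂₀ + B.m * k₁ * u₀ * ω₀ + B.m * k₂ * w₀ - B.ζ with hq₂
  refine ⟨q₁ * Real.cos θ₀ - q₂ * Real.sin θ₀ + B.lam * y₀,
    q₁ * Real.sin θ₀ + q₂ * Real.cos θ₀ - B.lam * x₀, ?_, ?_⟩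
  · simp only [PlanarModel.v₁, PlanarModel.p₁, planarModel]
    rw [div_eq_iff h1]
    linear_combination q₁ * Real.sin_sq_add_cos_sq θ₀ + hq₁
  · simp only [PlanarModel.v₂, PlanarModel.p₂, planarModel]
    rw [div_eq_iff h2]
    linear_combination q₂ * Real.sin_sq_add_cos_sq θ₀ + hq₂

/-- The rotor can be driven so that the body turns in a prescribed way; the translational motion
is then governed by the planar model. -/
theorem exists_isMotion {k₁ k₂ K₁ K₂ : ℝ} {s θ x y : ℝ → ℝ} (hs : ContDiff ℝ ∞ s)
    (hθ : ContDiff ℝ ∞ θ) (hx : ContDiff ℝ ∞ x) (hy : ContDiff ℝ ∞ y)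
    (h : (B.planarModel k₁ k₂ K₁ K₂).IsPath θ (fun t => Real.sin (s t)) x y) (T Ω₀ : ℝ) :
    ∃ Ω : ℝ → ℝ, ContDiff ℝ ∞ Ω ∧ Ω 0 = Ω₀ ∧
      B.IsMotion T (fun t => k₁ * Real.sin (s t)) (fun t => k₂ * Real.sin (s t)) Ω x y θ
        (fun t => (B.planarModel k₁ k₂ K₁ K₂).v₁ (θ t) (deriv θ t) (Real.sin (s t))
          (deriv (fun τ => Real.sin (s τ)) t) (x t) (y t))
        (fun t => (B.planarModel k₁ k₂ K₁ K₂).v₂ (θ t) (deriv θ t) (Real.sin (s t))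
          (deriv (fun τ => Real.sin (s τ)) t) (x t) (y t)) (deriv θ) := by
  set R := B.planarModel k₁ k₂ K₁ K₂ with hR
  set u : ℝ → ℝ := fun t => Real.sin (s t) with hu
  have hus : ContDiff ℝ ∞ u := Real.contDiff_sin.comp hs
  have hws := PlanarModel.contDiff_deriv hus
  have hωs := PlanarModel.contDiff_deriv hθ
  set V₁ : ℝ → ℝ := fun t => R.v₁ (θ t) (deriv θ t) (u t) (deriv u t) (x t) (y t) with hV₁
  set V₂ : ℝ → ℝ := fun t => R.v₂ (θ t) (deriv θ t) (u t) (deriv u t) (x t) (y t) with hV₂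
  have hV₁s : ContDiff ℝ ∞ V₁ := R.contDiff_v₁ hθ hωs hus hws hx hy
  have hV₂s : ContDiff ℝ ∞ V₂ := R.contDiff_v₂ hθ hωs hus hws hx hy
  have hp₁s := R.contDiff_p₁ hθ hx hy
  have hp₂s := R.contDiff_p₂ hθ hx hy
  have hud : ∀ (k t : ℝ), deriv (fun τ => k * u τ) t = k * deriv u t := fun k t =>
    deriv_const_mul k ((hus.differentiable (by simp)) t)
  have hP₁ : ∀ Ω t : ℝ, B.P₁ (k₁ * u t) (k₂ * u t) (deriv (fun τ => k₁ * u τ) t)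
      (deriv (fun τ => k₂ * u τ) t) Ω (V₁ t) (V₂ t) (deriv θ t)
      = R.p₁ (θ t) (x t) (y t) := by
    intro Ω t
    have h1 : R.a₁ * V₁ t = R.p₁ (θ t) (x t) (y t) + R.κ₂ * u t * deriv θ t - R.κ₁ * deriv u t :=
      mul_div_cancel₀ _ (B.planarModel_a₁_pos k₁ k₂ K₁ K₂).ne'
    rw [P₁_eq, hud]
    simp only [hR, planarModel] at h1 ⊢
    linear_combination h1
  have hP₂ : ∀ Ω t : ℝ, B.P₂ (k₁ * u t) (k₂ * u t) (deriv (fun τ => k₁ * u τ) t)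
      (deriv (fun τ => k₂ * u τ) t) Ω (V₁ t) (V₂ t) (deriv θ t)
      = R.p₂ (θ t) (x t) (y t) := by
    intro Ω t
    have h1 : R.a₂ * V₂ t = R.p₂ (θ t) (x t) (y t) - R.κ₁ * u t * deriv θ t - R.κ₂ * deriv u t :=
      mul_div_cancel₀ _ (B.planarModel_a₂_pos k₁ k₂ K₁ K₂).ne'
    rw [P₂_eq, hud]
    simp only [hR, planarModel] at h1 ⊢
    linear_combination h1
  -- The right-hand side of the third equation; by `hP₁` and `hP₂` it does not involve the rotor.
  set G : ℝ → ℝ := fun t => V₂ t * R.p₁ (θ t) (x t) (y t) - V₁ t * R.p₂ (θ t) (x t) (y t)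
    + B.ζ * V₁ t - B.χ * V₂ t with hG
  have hGs : ContDiff ℝ ∞ G := by fun_prop
  set Q : ℝ → ℝ := fun t => ∫ τ in (0 : ℝ)..t, G τ with hQ
  have hQd : ∀ t, HasDerivAt Q (G t) t := fun t =>
    intervalIntegral.integral_hasDerivAt_right (hGs.continuous.intervalIntegrable _ _)
      (hGs.continuous.stronglyMeasurableAtFilter _ _) hGs.continuous.continuousAt
  have hQs : ContDiff ℝ ∞ Q := by
    refine contDiff_infty_iff_deriv.2 ⟨fun t => (hQd t).differentiableAt, ?_⟩
    rwa [funext fun t => (hQd t).deriv]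
  set L : ℝ → ℝ := fun t => B.angularMomentum (k₁ * u t) (k₂ * u t) (k₁ * deriv u t)
    (k₂ * deriv u t) (V₁ t) (V₂ t) (deriv θ t) with hL
  have hLs : ContDiff ℝ ∞ L := by
    simp only [hL, angularMomentum]
    fun_prop
  have hIr := B.Ir_pos.ne'
  -- Solves `L + Ir * Ω = Q + const` for `Ω`, the constant being fixed by `Ω 0 = Ω₀`.
  refine ⟨fun t => Ω₀ + (Q t - L t + L 0) / B.Ir, by fun_prop, by simp [hQ], ?_⟩
  change B.IsMotion T (fun t => k₁ * u t) (fun t => k₂ * u t) _ x y θ V₁ V₂ (deriv θ)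
  have hθd : ∀ t, HasDerivAt θ (deriv θ t) t := fun t =>
    ((hθ.differentiable (by simp)) t).hasDerivAt
  refine ⟨fun t _ => (h.deriv_x t).hasDerivWithinAt, fun t _ => (h.deriv_y t).hasDerivWithinAt,
    fun t _ => (hθd t).hasDerivWithinAt, fun t _ => ?_, fun t _ => ?_, fun t _ => ?_⟩
  · simp only [hP₁, hP₂]
    refine ((h.hasDerivAt_p₁ (hθd t)).congr_deriv ?_).hasDerivWithinAt
    simp only [hR, planarModel, hV₂]; ring
  · simp only [hP₁, hP₂]
    refine ((h.hasDerivAt_p₂ (hθd t)).congr_deriv ?_).hasDerivWithinAt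
    simp only [hR, planarModel, hV₁]; ring
  · simp only [hP₁, hP₂]
    refine HasDerivAt.hasDerivWithinAt ?_
    refine (((hQd t).const_add (L 0 + B.Ir * Ω₀))).congr_of_eventuallyEq
      (Filter.Eventually.of_forall fun τ => ?_)
    simp only [P₃_eq, hud]
    change L τ + _ = _
    field_simp
    ring

end FluidBody

end

/-! ### Smooth steps and transitions -/

noncomputable section

open Real (smoothTransition)

theorem contDiff_smoothTransition : ContDiff ℝ ∞ smoothTransition :=
  Real.smoothTransition.contDiff

theorem hasDerivAt_smoothTransition (t : ℝ) :
    HasDerivAt smoothTransition (deriv smoothTransition t) t :=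
  ((contDiff_smoothTransition.differentiable (by simp)) t).hasDerivAt

theorem hasDerivAt_deriv_smoothTransition (t : ℝ) :
    HasDerivAt (deriv smoothTransition) (deriv (deriv smoothTransition) t) t :=
  (((PlanarModel.contDiff_deriv contDiff_smoothTransition).differentiable (by simp)) t).hasDerivAt

/-- The step attains its global minimum at each such point, the endpoint `0` included. The same
argument applies to the derivative, which is nonnegative and hence minimal where it vanishes. -/
theorem deriv_smoothTransition_of_nonpos {t : ℝ} (ht : t ≤ 0) : deriv smoothTransition t = 0 := by
  refine IsLocalMin.deriv_eq_zero (Filter.Eventually.of_forall fun x => ?_)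
  rw [Real.smoothTransition.zero_of_nonpos ht]
  exact Real.smoothTransition.nonneg x

theorem deriv_smoothTransition_of_one_le {t : ℝ} (ht : 1 ≤ t) : deriv smoothTransition t = 0 := by
  refine IsLocalMax.deriv_eq_zero (Filter.Eventually.of_forall fun x => ?_)
  rw [Real.smoothTransition.one_of_one_le ht]
  exact Real.smoothTransition.le_one x

theorem deriv_deriv_smoothTransition_of_nonpos {t : ℝ} (ht : t ≤ 0) :
    deriv (deriv smoothTransition) t = 0 := by
  refine IsLocalMin.deriv_eq_zero (Filter.Eventually.of_forall fun x => ?_)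
  rw [deriv_smoothTransition_of_nonpos ht]
  exact Real.smoothTransition.monotone.deriv_nonneg

theorem deriv_deriv_smoothTransition_of_one_le {t : ℝ} (ht : 1 ≤ t) :
    deriv (deriv smoothTransition) t = 0 := by
  refine IsLocalMin.deriv_eq_zero (Filter.Eventually.of_forall fun x => ?_)
  rw [deriv_smoothTransition_of_one_le ht]
  exact Real.smoothTransition.monotone.deriv_nonneg

theorem exists_bound_deriv_smoothTransition : ∃ C : ℝ, 0 ≤ C ∧
    (∀ t, |deriv smoothTransition t| ≤ C) ∧ ∀ t, |deriv (deriv smoothTransition) t| ≤ C := by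
  have h1 := PlanarModel.contDiff_deriv contDiff_smoothTransition
  have h2 := PlanarModel.contDiff_deriv h1
  obtain ⟨C₁, hC₁⟩ := isCompact_Icc.exists_bound_of_continuousOn (s := Icc (0 : ℝ) 1)
    h1.continuous.continuousOn
  obtain ⟨C₂, hC₂⟩ := isCompact_Icc.exists_bound_of_continuousOn (s := Icc (0 : ℝ) 1)
    h2.continuous.continuousOn
  refine ⟨max 0 (max C₁ C₂), le_max_left _ _, fun t => ?_, fun t => ?_⟩
  · rcases le_total t 0 with h | h
    · simp [deriv_smoothTransition_of_nonpos h]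
    rcases le_total 1 t with h' | h'
    · simp [deriv_smoothTransition_of_one_le h']
    · exact (hC₁ t ⟨h, h'⟩).trans ((le_max_left _ _).trans (le_max_right _ _))
  · rcases le_total t 0 with h | h
    · simp [deriv_deriv_smoothTransition_of_nonpos h]
    rcases le_total 1 t with h' | h'
    · simp [deriv_deriv_smoothTransition_of_one_le h']
    · exact (hC₂ t ⟨h, h'⟩).trans ((le_max_right _ _).trans (le_max_right _ _))

/-- A smooth function that starts at time `0` like `a + b * t` and equals `c` from time `1` on. -/
def approach (a b c t : ℝ) : ℝ :=
  (1 - smoothTransition (2 * t - 1)) * (a + b * t) + smoothTransition (2 * t - 1) * c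

theorem contDiff_approach (a b c : ℝ) : ContDiff ℝ ∞ (approach a b c) := by
  have h : ContDiff ℝ ∞ fun t : ℝ => smoothTransition (2 * t - 1) :=
    contDiff_smoothTransition.comp (by fun_prop)
  unfold approach
  fun_prop

theorem hasDerivAt_approach (a b c t : ℝ) :
    HasDerivAt (approach a b c) (deriv (approach a b c) t) t :=
  (((contDiff_approach a b c).differentiable (by simp)) t).hasDerivAt

theorem approach_of_le {a b c t : ℝ} (ht : t ≤ 1 / 2) : approach a b c t = a + b * t := by
  rw [approach, Real.smoothTransition.zero_of_nonpos (by linarith)]; ring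

theorem approach_of_ge {a b c t : ℝ} (ht : 1 ≤ t) : approach a b c t = c := by
  rw [approach, Real.smoothTransition.one_of_one_le (by linarith)]; ring

theorem deriv_approach_of_ge {a b c t : ℝ} (ht : 1 ≤ t) : deriv (approach a b c) t = 0 := by
  have hlin : HasDerivAt (fun t : ℝ => 2 * t - 1) 2 t :=
    (((hasDerivAt_id t).const_mul 2).sub_const 1).congr_deriv (by norm_num)
  have h := (hasDerivAt_smoothTransition (2 * t - 1)).comp t hlin
  rw [deriv_smoothTransition_of_one_le (by linarith)] at h
  have hl : HasDerivAt (fun t : ℝ => a + b * t) b t :=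
    (((hasDerivAt_id t).const_mul b).const_add a).congr_deriv (by norm_num)
  refine HasDerivAt.deriv ((((h.const_sub 1).mul hl).add (h.mul_const c)).congr_deriv ?_)
  simp [Real.smoothTransition.one_of_one_le (by linarith : (1 : ℝ) ≤ 2 * t - 1)]

theorem eventuallyEq_approach (a b c : ℝ) :
    approach a b c =ᶠ[nhds 0] fun t => a + b * t := by
  filter_upwards [Iio_mem_nhds (by norm_num : (0 : ℝ) < 1 / 2)] with t ht
  exact approach_of_le (le_of_lt ht)

theorem deriv_zero_of_eventuallyEq {f : ℝ → ℝ} {a b : ℝ}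
    (h : f =ᶠ[nhds 0] fun t => a + b * t) : deriv f 0 = b := by
  rw [h.deriv_eq]
  exact HasDerivAt.deriv ((((hasDerivAt_id (0 : ℝ)).const_mul b).const_add a).congr_deriv
    (by norm_num))

/-- The bound `1 / 2` keeps `f` away from `±1`, where `arcsin` is not smooth. It is the reason why
the prescribed displacements of the particle have to be small. -/
theorem contDiff_arcsin_comp {f : ℝ → ℝ} (hf : ContDiff ℝ ∞ f) (h : ∀ t, |f t| ≤ 1 / 2) :
    ContDiff ℝ ∞ fun t => Real.arcsin (f t) := by
  refine contDiff_iff_contDiffAt.2 fun t => ?_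
  have := abs_le.1 (h t)
  exact (Real.contDiffAt_arcsin (by linarith) (by linarith)).comp t hf.contDiffAt

theorem sin_arcsin_of_abs_le {y : ℝ} (h : |y| ≤ 1 / 2) : Real.sin (Real.arcsin y) = y := by
  have := abs_le.1 h
  exact Real.sin_arcsin (by linarith) (by linarith)

theorem contDiff_smoothTransition_sub (a : ℝ) :
    ContDiff ℝ ∞ fun t => smoothTransition (t - a) :=
  contDiff_smoothTransition.comp (by fun_prop)

theorem hasDerivAt_smoothTransition_sub (a t : ℝ) :
    HasDerivAt (fun t => smoothTransition (t - a)) (deriv smoothTransition (t - a)) t :=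
  (hasDerivAt_smoothTransition (t - a)).comp_sub_const t a

theorem hasDerivAt_primitive {f : ℝ → ℝ} (hf : Continuous f) (t : ℝ) :
    HasDerivAt (fun t => ∫ τ in (0 : ℝ)..t, f τ) (f t) t :=
  intervalIntegral.integral_hasDerivAt_right (hf.intervalIntegrable _ _)
    (hf.stronglyMeasurableAtFilter _ _) hf.continuousAt

end

/-! ### Controllability without circulation -/

noncomputable section

open Real (smoothTransition)

theorem eq_sub_of_hasDerivAt_eq {f g h : ℝ → ℝ} (hf : ∀ t, HasDerivAt f (h t) t)
    (hg : ∀ t, HasDerivAt g (h t) t) (a b : ℝ) : f b - f a = g b - g a := by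
  have := is_const_of_deriv_eq_zero (f := f - g)
    (fun t => ((hf t).sub (hg t)).differentiableAt)
    (fun t => ((hf t).sub (hg t)).deriv.trans (sub_self _)) a b
  simp only [Pi.sub_apply] at this
  linarith

/-- A control `g` on a full number of turns produces any prescribed pair of integrals. -/
theorem exists_fourier_primitives (c₁ c₂ : ℝ) : ∃ C D : ℝ → ℝ,
    (∀ θ, HasDerivAt C ((c₁ * Real.cos θ + c₂ * Real.sin θ) * Real.cos θ) θ) ∧
    (∀ θ, HasDerivAt D ((c₁ * Real.cos θ + c₂ * Real.sin θ) * Real.sin θ) θ) ∧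
    ∀ (θ : ℝ) (n : ℕ), C (θ + 2 * Real.pi * n) - C θ = Real.pi * n * c₁ ∧
      D (θ + 2 * Real.pi * n) - D θ = Real.pi * n * c₂ := by
  -- Over whole turns only the secular terms `c₁ * θ / 2` and `c₂ * θ / 2` survive.
  refine ⟨fun θ => c₁ * (θ / 2 + Real.sin θ * Real.cos θ / 2) + c₂ * (Real.sin θ ^ 2 / 2),
    fun θ => c₁ * (Real.sin θ ^ 2 / 2) + c₂ * (θ / 2 - Real.sin θ * Real.cos θ / 2),
    fun θ => ?_, fun θ => ?_, fun θ n => ?_⟩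
  · have h1 := (((hasDerivAt_id θ).div_const 2).add
      (((Real.hasDerivAt_sin θ).mul (Real.hasDerivAt_cos θ)).div_const 2)).const_mul c₁
    have h2 := (((Real.hasDerivAt_sin θ).pow 2).div_const 2).const_mul c₂
    refine (h1.add h2).congr_deriv ?_
    push_cast
    linear_combination (-c₁ / 2) * Real.sin_sq_add_cos_sq θ
  · have h1 := (((hasDerivAt_id θ).div_const 2).sub
      (((Real.hasDerivAt_sin θ).mul (Real.hasDerivAt_cos θ)).div_const 2)).const_mul c₂
    have h2 := (((Real.hasDerivAt_sin θ).pow 2).div_const 2).const_mul c₁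
    refine (h2.add h1).congr_deriv ?_
    push_cast
    linear_combination (-c₂ / 2) * Real.sin_sq_add_cos_sq θ
  · have e : θ + 2 * Real.pi * n = θ + n * (2 * Real.pi) := by ring
    have hs : Real.sin (θ + 2 * Real.pi * n) = Real.sin θ := by
      rw [e]; exact Real.sin_add_nat_mul_two_pi θ n
    have hc : Real.cos (θ + 2 * Real.pi * n) = Real.cos θ := by
      rw [e]; exact Real.cos_add_nat_mul_two_pi θ n
    constructor
    · simp only [hs, hc]; ring
    · simp only [hs, hc]; ring

namespace PlanarModel

variable {R : PlanarModel} {θ u x y : ℝ → ℝ}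

/-- Rate of the displacement in the absence of circulation due to the momentum alone. -/
def driftX (R : PlanarModel) (θ : ℝ) : ℝ :=
  (R.K₁ * Real.cos θ + R.K₂ * Real.sin θ) * Real.cos θ / R.a₁
    - (-R.K₁ * Real.sin θ + R.K₂ * Real.cos θ) * Real.sin θ / R.a₂

def driftY (R : PlanarModel) (θ : ℝ) : ℝ :=
  (R.K₁ * Real.cos θ + R.K₂ * Real.sin θ) * Real.sin θ / R.a₁
    + (-R.K₁ * Real.sin θ + R.K₂ * Real.cos θ) * Real.cos θ / R.a₂

/-- Displacement of the body due to that of the particle. -/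
def shiftX (R : PlanarModel) (θ u : ℝ) : ℝ :=
  -R.κ₁ * u * Real.cos θ / R.a₁ + R.κ₂ * u * Real.sin θ / R.a₂

def shiftY (R : PlanarModel) (θ u : ℝ) : ℝ :=
  -R.κ₁ * u * Real.sin θ / R.a₁ - R.κ₂ * u * Real.cos θ / R.a₂

theorem continuous_driftX (R : PlanarModel) : Continuous R.driftX := by
  unfold driftX; fun_prop

theorem continuous_driftY (R : PlanarModel) : Continuous R.driftY := by
  unfold driftY; fun_prop

/-- Uniformity in the angle makes the drift over a fixed time bounded independently of the number of
turns. -/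
theorem exists_bound_drift (R : PlanarModel) :
    ∃ D : ℝ, ∀ θ, |R.driftX θ| ≤ D ∧ |R.driftY θ| ≤ D := by
  have key : ∀ a b c d : ℝ, |a| ≤ 1 → |b| ≤ 1 → |c| ≤ 1 → |R.K₁ * a * c / d + R.K₂ * b * c / d|
      ≤ (|R.K₁| + |R.K₂|) / |d| := by
    intro a b c d ha hb hc
    rw [← add_div, abs_div]
    gcongr
    refine (abs_add_le _ _).trans ?_
    rw [abs_mul, abs_mul, abs_mul, abs_mul]
    have h1 : |a| * |c| ≤ 1 := mul_le_one₀ ha (abs_nonneg _) hc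
    have h2 : |b| * |c| ≤ 1 := mul_le_one₀ hb (abs_nonneg _) hc
    nlinarith [abs_nonneg R.K₁, abs_nonneg R.K₂]
  refine ⟨(|R.K₁| + |R.K₂|) / |R.a₁| + (|R.K₁| + |R.K₂|) / |R.a₂|, fun θ => ⟨?_, ?_⟩⟩
  · have h1 := key _ _ _ R.a₁ (Real.abs_cos_le_one θ) (Real.abs_sin_le_one θ)
      (Real.abs_cos_le_one θ)
    have h2 := key (Real.sin θ) (-Real.cos θ) (Real.sin θ) R.a₂ (Real.abs_sin_le_one θ)
      (by rw [abs_neg]; exact Real.abs_cos_le_one θ) (Real.abs_sin_le_one θ)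
    refine le_trans (le_of_eq ?_) ((abs_add_le _ _).trans (add_le_add h1 h2))
    congr 1
    simp only [driftX]; ring
  · have h1 := key _ _ _ R.a₁ (Real.abs_cos_le_one θ) (Real.abs_sin_le_one θ)
      (Real.abs_sin_le_one θ)
    have h2 := key (-Real.sin θ) (Real.cos θ) (Real.cos θ) R.a₂
      (by rw [abs_neg]; exact Real.abs_sin_le_one θ) (Real.abs_cos_le_one θ)
      (Real.abs_cos_le_one θ)
    refine le_trans (le_of_eq ?_) ((abs_add_le _ _).trans (add_le_add h1 h2))
    congr 1
    simp only [driftY]; ring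

/-- Displacement of the body in the absence of circulation. -/
theorem IsPath.displacement (h : R.IsPath θ u x y) (hl : R.lam = 0) (hχ : R.χ = 0) (hζ : R.ζ = 0)
    (hθ : Differentiable ℝ θ) (hu : Differentiable ℝ u) {C D : ℝ → ℝ}
    (hC : ∀ t, HasDerivAt C (u t * deriv θ t * Real.cos (θ t)) t)
    (hD : ∀ t, HasDerivAt D (u t * deriv θ t * Real.sin (θ t)) t) (T : ℝ) :
    x T - x 0 = (∫ t in (0 : ℝ)..T, R.driftX (θ t)) + (R.shiftX (θ T) (u T) - R.shiftX (θ 0) (u 0))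
      + (1 / R.a₁ - 1 / R.a₂) * (R.κ₂ * (C T - C 0) - R.κ₁ * (D T - D 0)) ∧
    y T - y 0 = (∫ t in (0 : ℝ)..T, R.driftY (θ t)) + (R.shiftY (θ T) (u T) - R.shiftY (θ 0) (u 0))
      + (1 / R.a₁ - 1 / R.a₂) * (R.κ₂ * (D T - D 0) + R.κ₁ * (C T - C 0)) := by
  have hX := hasDerivAt_primitive (R.continuous_driftX.comp hθ.continuous)
  have hY := hasDerivAt_primitive (R.continuous_driftY.comp hθ.continuous)
  have hs := fun t => (hθ t).hasDerivAt.sin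
  have hc := fun t => (hθ t).hasDerivAt.cos
  have hud := fun t => (hu t).hasDerivAt
  constructor
  · have hg : ∀ t, HasDerivAt (fun t => (∫ τ in (0 : ℝ)..t, R.driftX (θ τ)) + R.shiftX (θ t) (u t)
        + (1 / R.a₁ - 1 / R.a₂) * (R.κ₂ * C t - R.κ₁ * D t)) _ t := fun t =>
      ((hX t).add (((((hud t).const_mul (-R.κ₁)).mul (hc t)).div_const R.a₁).add
        ((((hud t).const_mul R.κ₂).mul (hs t)).div_const R.a₂))).add
        ((((hC t).const_mul R.κ₂).sub ((hD t).const_mul R.κ₁)).const_mul (1 / R.a₁ - 1 / R.a₂))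
    have := eq_sub_of_hasDerivAt_eq h.deriv_x (fun t => (hg t).congr_deriv ?_) 0 T
    · simp only [intervalIntegral.integral_same] at this
      linear_combination this
    · simp only [v₁, v₂, p₁, p₂, hl, hχ, hζ, driftX, Function.comp_apply]
      ring
  · have hg : ∀ t, HasDerivAt (fun t => (∫ τ in (0 : ℝ)..t, R.driftY (θ τ)) + R.shiftY (θ t) (u t)
        + (1 / R.a₁ - 1 / R.a₂) * (R.κ₂ * D t + R.κ₁ * C t)) _ t := fun t =>
      ((hY t).add (((((hud t).const_mul (-R.κ₁)).mul (hs t)).div_const R.a₁).sub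
        ((((hud t).const_mul R.κ₂).mul (hc t)).div_const R.a₂))).add
        ((((hD t).const_mul R.κ₂).add ((hC t).const_mul R.κ₁)).const_mul (1 / R.a₁ - 1 / R.a₂))
    have := eq_sub_of_hasDerivAt_eq h.deriv_y (fun t => (hg t).congr_deriv ?_) 0 T
    · simp only [intervalIntegral.integral_same] at this
      linear_combination this
    · simp only [v₁, v₂, p₁, p₂, hl, hχ, hζ, driftY, Function.comp_apply]
      ring

/-- Controllability with prescribed boundary data. -/
def Controllable (R : PlanarModel) : Prop :=
  ∀ x₀ y₀ θ₀ ω₀ s₀ ds₀ x₁ y₁ θ₁ s₁ : ℝ, ∃ T : ℝ, 0 < T ∧ ∃ s θ x y : ℝ → ℝ,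
    ContDiff ℝ ∞ s ∧ ContDiff ℝ ∞ θ ∧ ContDiff ℝ ∞ x ∧ ContDiff ℝ ∞ y ∧
    s 0 = s₀ ∧ deriv s 0 = ds₀ ∧ s T = s₁ ∧ θ 0 = θ₀ ∧ deriv θ 0 = ω₀ ∧ θ T = θ₁ ∧
    R.IsPath θ (fun t => Real.sin (s t)) x y ∧ x 0 = x₀ ∧ y 0 = y₀ ∧ x T = x₁ ∧ y T = y₁

-- Six unit stages: on `[0, 1]` the initial data are absorbed and the angle becomes `θ₁`; then the
-- particle moves to the start of its regime `g`; the body makes `N` turns while `u = g`; the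
-- particle returns to `0`; the body turns back; the particle goes to `s₁`. Since `u = 0` while
-- turning back, the gain of the turns is not undone.
set_option maxHeartbeats 1600000 in
theorem controllable_of_lam_eq_zero (hne : R.a₁ ≠ R.a₂)
    (hκ : R.κ₁ ≠ 0 ∨ R.κ₂ ≠ 0) (hl : R.lam = 0) (hχ : R.χ = 0) (hζ : R.ζ = 0) :
    R.Controllable := by
  intro x₀ y₀ θ₀ ω₀ s₀ ds₀ x₁ y₁ θ₁ s₁
  set δ := 1 / R.a₁ - 1 / R.a₂ with hδ
  have hδ0 : δ ≠ 0 := by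
    rw [hδ, sub_ne_zero]
    intro h
    exact hne (by simpa using h)
  set k := R.κ₁ ^ 2 + R.κ₂ ^ 2 with hk
  have hk0 : 0 < k := by
    rcases hκ with h | h <;> positivity
  obtain ⟨B, hB⟩ := R.exists_bound_drift
  set sA := approach s₀ ds₀ 0 with hsA
  set θA := approach θ₀ ω₀ θ₁ with hθA
  have hsAs : ContDiff ℝ ∞ sA := contDiff_approach _ _ _
  have hθAs : ContDiff ℝ ∞ θA := contDiff_approach _ _ _
  have hωAs := contDiff_deriv hθAs
  set fC : ℝ → ℝ := fun t => Real.sin (sA t) * deriv θA t * Real.cos (θA t) with hfC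
  set fD : ℝ → ℝ := fun t => Real.sin (sA t) * deriv θA t * Real.sin (θA t) with hfD
  have hfCc : Continuous fC := ContDiff.continuous (n := ∞) (by fun_prop)
  have hfDc : Continuous fD := ContDiff.continuous (n := ∞) (by fun_prop)
  set IC := ∫ t in (0 : ℝ)..6, fC t with hIC
  set ID := ∫ t in (0 : ℝ)..6, fD t with hID
  set eX := x₁ - x₀ - (R.shiftX θ₁ (Real.sin s₁) - R.shiftX θ₀ (Real.sin s₀)) with heX
  set eY := y₁ - y₀ - (R.shiftY θ₁ (Real.sin s₁) - R.shiftY θ₀ (Real.sin s₀)) with heY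
  -- All quantities in this bound are independent of `N`; the factor 4 gives `|c₁|, |c₂| ≤ 1 / 4`
  -- and thus `|g| ≤ 1 / 2`.
  obtain ⟨N, hN⟩ := exists_nat_gt (4 * (((|R.κ₁| + |R.κ₂|) * (|eX| + |eY| + 6 * B)) / |δ * k|
    + |IC| + |ID|))
  set θ : ℝ → ℝ := fun t => θA t + 2 * Real.pi * N *
    (smoothTransition (t - 2) - smoothTransition (t - 4)) with hθ
  have hθs : ContDiff ℝ ∞ θ := by
    have h1 := contDiff_smoothTransition_sub 2
    have h2 := contDiff_smoothTransition_sub 4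
    fun_prop
  have hdrift : ∀ f : ℝ → ℝ, (∀ θ, |f θ| ≤ B) → |∫ t in (0 : ℝ)..6, f (θ t)| ≤ 6 * B := by
    intro f hf
    have := intervalIntegral.norm_integral_le_of_norm_le_const (a := 0) (b := 6)
      (f := fun t => f (θ t)) (C := B) (fun t _ => hf (θ t))
    rw [Real.norm_eq_abs] at this
    norm_num at this
    linarith
  set X := eX - ∫ t in (0 : ℝ)..6, R.driftX (θ t) with hX
  set Y := eY - ∫ t in (0 : ℝ)..6, R.driftY (θ t) with hY
  have hXb : |X| ≤ |eX| + |eY| + 6 * B := by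
    have := hdrift _ fun θ => (hB θ).1
    have := abs_sub eX (∫ t in (0 : ℝ)..6, R.driftX (θ t))
    have := abs_nonneg eY
    linarith
  have hYb : |Y| ≤ |eX| + |eY| + 6 * B := by
    have := hdrift _ fun θ => (hB θ).2
    have := abs_sub eY (∫ t in (0 : ℝ)..6, R.driftY (θ t))
    have := abs_nonneg eX
    linarith
  -- The values that the integrals of `u * deriv θ * cos θ` and `u * deriv θ * sin θ` must take: the
  -- solution of the linear system in `hlin1`, `hlin2`, whose matrix is `δ` times a similarity.
  set C₁ := (R.κ₂ * X + R.κ₁ * Y) / (δ * k) with hC₁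
  set D₁ := (R.κ₂ * Y - R.κ₁ * X) / (δ * k) with hD₁
  have hQ0 : 0 ≤ ((|R.κ₁| + |R.κ₂|) * (|eX| + |eY| + 6 * B)) / |δ * k| := by
    have := (abs_nonneg X).trans hXb
    positivity
  have hC₁b : |C₁| ≤ ((|R.κ₁| + |R.κ₂|) * (|eX| + |eY| + 6 * B)) / |δ * k| := by
    rw [hC₁, abs_div]
    gcongr
    refine (abs_add_le _ _).trans ?_
    rw [abs_mul, abs_mul]
    nlinarith [abs_nonneg R.κ₁, abs_nonneg R.κ₂]
  have hD₁b : |D₁| ≤ ((|R.κ₁| + |R.κ₂|) * (|eX| + |eY| + 6 * B)) / |δ * k| := by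
    rw [hD₁, abs_div]
    gcongr
    refine (abs_sub _ _).trans ?_
    rw [abs_mul, abs_mul]
    nlinarith [abs_nonneg R.κ₁, abs_nonneg R.κ₂]
  have hN0 : (0 : ℝ) < N := by
    have := abs_nonneg IC
    have := abs_nonneg ID
    linarith
  have hπN : (0 : ℝ) < Real.pi * N := mul_pos Real.pi_pos hN0
  have hNπ : (N : ℝ) ≤ Real.pi * N := by nlinarith [Real.pi_gt_three]
  -- The first stage already contributes `IC` and `ID`; the turns supply the rest.
  set c₁ := (C₁ - IC) / (Real.pi * N) with hc₁
  set c₂ := (D₁ - ID) / (Real.pi * N) with hc₂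
  have hc₁b : |c₁| ≤ 1 / 4 := by
    rw [hc₁, abs_div, abs_of_pos hπN, div_le_iff₀ hπN]
    have := abs_sub C₁ IC
    have := abs_nonneg ID
    linarith
  have hc₂b : |c₂| ≤ 1 / 4 := by
    rw [hc₂, abs_div, abs_of_pos hπN, div_le_iff₀ hπN]
    have := abs_sub D₁ ID
    have := abs_nonneg IC
    linarith
  set g : ℝ → ℝ := fun t => (smoothTransition (t - 1) - smoothTransition (t - 3)) *
    (c₁ * Real.cos (θ t) + c₂ * Real.sin (θ t)) with hg
  have hgb : ∀ t, |g t| ≤ 1 / 2 := by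
    intro t
    have h1 : 0 ≤ smoothTransition (t - 1) - smoothTransition (t - 3) :=
      sub_nonneg.2 (Real.smoothTransition.monotone (by linarith))
    have h2 : smoothTransition (t - 1) - smoothTransition (t - 3) ≤ 1 := by
      have := Real.smoothTransition.le_one (t - 1)
      have := Real.smoothTransition.nonneg (t - 3)
      linarith
    have h3 : |c₁ * Real.cos (θ t) + c₂ * Real.sin (θ t)| ≤ 1 / 2 := by
      refine (abs_add_le _ _).trans ?_
      rw [abs_mul, abs_mul]
      nlinarith [abs_nonneg c₁, abs_nonneg c₂, Real.abs_cos_le_one (θ t),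
        Real.abs_sin_le_one (θ t)]
    rw [hg, abs_mul, abs_of_nonneg h1]
    nlinarith [abs_nonneg (c₁ * Real.cos (θ t) + c₂ * Real.sin (θ t))]
  have hgs : ContDiff ℝ ∞ g := by
    have h1 := contDiff_smoothTransition_sub 1
    have h2 := contDiff_smoothTransition_sub 3
    fun_prop
  set s : ℝ → ℝ := fun t => sA t + Real.arcsin (g t) + s₁ * smoothTransition (t - 5) with hs
  have hss : ContDiff ℝ ∞ s := by
    have h1 := contDiff_arcsin_comp hgs hgb
    have h2 := contDiff_smoothTransition_sub 5
    fun_prop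
  set u : ℝ → ℝ := fun t => Real.sin (s t) with hu
  have hus : ContDiff ℝ ∞ u := Real.contDiff_sin.comp hss
  obtain ⟨x, y, hx, hy, hx0, hy0, hpath⟩ := R.exists_isPath hθs hus x₀ y₀
  obtain ⟨GC, GD, hGC, hGD, hG⟩ := exists_fourier_primitives c₁ c₂
  -- The angle without the turning back, which contributes nothing to the integrals.
  set β : ℝ → ℝ := fun t => θ₁ + 2 * Real.pi * N * smoothTransition (t - 2) with hβ
  have hβd : ∀ t, HasDerivAt β (2 * Real.pi * N * deriv smoothTransition (t - 2)) t := fun t =>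
    ((hasDerivAt_smoothTransition_sub 2 t).const_mul _).const_add θ₁
  have hθd : ∀ t, deriv θ t = deriv θA t + 2 * Real.pi * N *
      (deriv smoothTransition (t - 2) - deriv smoothTransition (t - 4)) := fun t =>
    ((hasDerivAt_approach θ₀ ω₀ θ₁ t).add (((hasDerivAt_smoothTransition_sub 2 t).sub
      (hasDerivAt_smoothTransition_sub 4 t)).const_mul _)).deriv
  -- either the body is at rest or the particle follows one of the two regimes
  have hcases : ∀ t,
      (u t = Real.sin (sA t) ∧ θ t = θA t ∧ deriv θ t = deriv θA t ∧
        deriv smoothTransition (t - 2) = 0) ∨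
      (deriv θA t = 0 ∧ deriv θ t = 0 ∧ deriv smoothTransition (t - 2) = 0) ∨
      (deriv θA t = 0 ∧ u t = c₁ * Real.cos (β t) + c₂ * Real.sin (β t) ∧ θ t = β t ∧
        deriv θ t = 2 * Real.pi * N * deriv smoothTransition (t - 2)) ∨
      (Real.sin (sA t) = 0 ∧ u t = 0 ∧ deriv smoothTransition (t - 2) = 0) := by
    intro t
    rcases le_total t 1 with h1 | h1
    · left
      have e2 := Real.smoothTransition.zero_of_nonpos (by linarith : t - 2 ≤ 0)
      have e4 := Real.smoothTransition.zero_of_nonpos (by linarith : t - 4 ≤ 0)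
      refine ⟨?_, ?_, ?_, deriv_smoothTransition_of_nonpos (by linarith)⟩
      · simp only [hu, hs, hg, Real.smoothTransition.zero_of_nonpos (by linarith : t - 1 ≤ 0),
          Real.smoothTransition.zero_of_nonpos (by linarith : t - 3 ≤ 0),
          Real.smoothTransition.zero_of_nonpos (by linarith : t - 5 ≤ 0)]
        simp
      · simp [hθ, e2, e4]
      · rw [hθd, deriv_smoothTransition_of_nonpos (by linarith),
          deriv_smoothTransition_of_nonpos (by linarith)]
        simp
    have hA0 : deriv θA t = 0 := deriv_approach_of_ge h1
    have hs0 : sA t = 0 := approach_of_ge h1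
    have hθ1 : θA t = θ₁ := approach_of_ge h1
    right
    rcases le_total t 2 with h2 | h2
    · left
      have e2 := deriv_smoothTransition_of_nonpos (by linarith : t - 2 ≤ 0)
      have e4 := deriv_smoothTransition_of_nonpos (by linarith : t - 4 ≤ 0)
      exact ⟨hA0, by rw [hθd, hA0, e2, e4]; ring, e2⟩
    rcases le_total t 3 with h3 | h3
    · right; left
      have e4 := Real.smoothTransition.zero_of_nonpos (by linarith : t - 4 ≤ 0)
      have e : θ t = β t := by simp [hθ, hβ, e4, hθ1]
      refine ⟨hA0, ?_, e, ?_⟩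
      · have hgt : g t = c₁ * Real.cos (β t) + c₂ * Real.sin (β t) := by
          simp only [hg, Real.smoothTransition.one_of_one_le (by linarith : 1 ≤ t - 1),
            Real.smoothTransition.zero_of_nonpos (by linarith : t - 3 ≤ 0), e]
          ring
        rw [← hgt]
        simp only [hu, hs, hs0,
          Real.smoothTransition.zero_of_nonpos (by linarith : t - 5 ≤ 0)]
        rw [zero_add, mul_zero, add_zero, sin_arcsin_of_abs_le (hgb t)]
      · rw [hθd, hA0, deriv_smoothTransition_of_nonpos (by linarith : t - 4 ≤ 0)]; ring
    have e2 := deriv_smoothTransition_of_one_le (by linarith : 1 ≤ t - 2)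
    rcases le_total t 4 with h4 | h4
    · left
      have e4 := deriv_smoothTransition_of_nonpos (by linarith : t - 4 ≤ 0)
      exact ⟨hA0, by rw [hθd, hA0, e2, e4]; ring, e2⟩
    rcases le_total t 5 with h5 | h5
    · right; right
      refine ⟨by simp [hs0], ?_, e2⟩
      simp only [hu, hs, hg, hs0, Real.smoothTransition.one_of_one_le (by linarith : 1 ≤ t - 1),
          Real.smoothTransition.one_of_one_le (by linarith : 1 ≤ t - 3),
          Real.smoothTransition.zero_of_nonpos (by linarith : t - 5 ≤ 0)]
      simp
    · left
      have e4 := deriv_smoothTransition_of_one_le (by linarith : 1 ≤ t - 4)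
      exact ⟨hA0, by rw [hθd, hA0, e2, e4]; ring, e2⟩
  have hCd : ∀ t, HasDerivAt (fun t => (∫ τ in (0 : ℝ)..t, fC τ) + GC (β t))
      (u t * deriv θ t * Real.cos (θ t)) t := by
    intro t
    refine ((hasDerivAt_primitive hfCc t).add ((hGC (β t)).comp t (hβd t))).congr_deriv ?_
    simp only [hfC]
    rcases hcases t with ⟨e1, e2, e3, e4⟩ | ⟨e1, e2, e3⟩ | ⟨e1, e2, e3, e4⟩ | ⟨e1, e2, e3⟩
    · rw [e1, e2, e3, e4]; ring
    · rw [e1, e2, e3]; ring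
    · rw [e1, e2, e3, e4]; ring
    · rw [e1, e2, e3]; ring
  have hDd : ∀ t, HasDerivAt (fun t => (∫ τ in (0 : ℝ)..t, fD τ) + GD (β t))
      (u t * deriv θ t * Real.sin (θ t)) t := by
    intro t
    refine ((hasDerivAt_primitive hfDc t).add ((hGD (β t)).comp t (hβd t))).congr_deriv ?_
    simp only [hfD]
    rcases hcases t with ⟨e1, e2, e3, e4⟩ | ⟨e1, e2, e3⟩ | ⟨e1, e2, e3, e4⟩ | ⟨e1, e2, e3⟩
    · rw [e1, e2, e3, e4]; ring
    · rw [e1, e2, e3]; ring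
    · rw [e1, e2, e3, e4]; ring
    · rw [e1, e2, e3]; ring
  have hS : ∀ t : ℝ, t ≤ 0 → smoothTransition t = 0 := fun t => Real.smoothTransition.zero_of_nonpos
  have hS' : ∀ t : ℝ, 1 ≤ t → smoothTransition t = 1 := fun t => Real.smoothTransition.one_of_one_le
  have hβ0 : β 0 = θ₁ := by
    simp only [hβ, hS (0 - 2) (by norm_num)]; ring
  have hβ6 : β 6 = θ₁ + 2 * Real.pi * N := by
    simp only [hβ, hS' (6 - 2) (by norm_num)]; ring
  have hsnear : s =ᶠ[nhds 0] fun t => s₀ + ds₀ * t := by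
    filter_upwards [Iio_mem_nhds (by norm_num : (0 : ℝ) < 1 / 2)] with t ht
    have ht' : t < 1 / 2 := ht
    simp only [hs, hg, hS (t - 1) (by linarith), hS (t - 3) (by linarith),
      hS (t - 5) (by linarith), hsA, approach_of_le ht'.le]
    simp
  have hθnear : θ =ᶠ[nhds 0] fun t => θ₀ + ω₀ * t := by
    filter_upwards [Iio_mem_nhds (by norm_num : (0 : ℝ) < 1 / 2)] with t ht
    have ht' : t < 1 / 2 := ht
    simp only [hθ, hS (t - 2) (by linarith), hS (t - 4) (by linarith), hθA, approach_of_le ht'.le]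
    simp
  have hs0 : s 0 = s₀ := by simpa using hsnear.eq_of_nhds
  have hθ0 : θ 0 = θ₀ := by simpa using hθnear.eq_of_nhds
  have hs6 : s 6 = s₁ := by
    simp only [hs, hg, hsA, approach_of_ge (by norm_num : (1 : ℝ) ≤ 6), hS' (6 - 1) (by norm_num),
      hS' (6 - 3) (by norm_num), hS' (6 - 5) (by norm_num)]
    simp
  have hθ6 : θ 6 = θ₁ := by
    simp only [hθ, hθA, approach_of_ge (by norm_num : (1 : ℝ) ≤ 6), hS' (6 - 2) (by norm_num),
      hS' (6 - 4) (by norm_num)]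
    simp
  have hu0 : u 0 = Real.sin s₀ := by rw [hu]; simp only [hs0]
  have hu6 : u 6 = Real.sin s₁ := by rw [hu]; simp only [hs6]
  obtain ⟨hdx, hdy⟩ := hpath.displacement hl hχ hζ (hθs.differentiable (by simp))
    (hus.differentiable (by simp)) hCd hDd 6
  have hC6 : IC + (GC (β 6) - GC (β 0)) = C₁ := by
    rw [hβ0, hβ6, (hG θ₁ N).1, hc₁]; field_simp; ring
  have hD6 : ID + (GD (β 6) - GD (β 0)) = D₁ := by
    rw [hβ0, hβ6, (hG θ₁ N).2, hc₂]; field_simp; ring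
  have hlin1 : δ * (R.κ₂ * C₁ - R.κ₁ * D₁) = X := by
    rw [hC₁, hD₁]; field_simp; rw [hk]; ring
  have hlin2 : δ * (R.κ₂ * D₁ + R.κ₁ * C₁) = Y := by
    rw [hC₁, hD₁]; field_simp; rw [hk]; ring
  rw [hθ6, hθ0, hu6, hu0, intervalIntegral.integral_same,
    intervalIntegral.integral_same, ← hδ, ← hIC, ← hID] at hdx hdy
  refine ⟨6, by norm_num, s, θ, x, y, hss, hθs, hx, hy, hs0, deriv_zero_of_eventuallyEq hsnear, hs6,
    hθ0, deriv_zero_of_eventuallyEq hθnear, hθ6, hpath, hx0, hy0, ?_, ?_⟩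
  · linear_combination hdx + hx0 + hlin1 + hX + heX + δ * (R.κ₂ * hC6 - R.κ₁ * hD6)
  · linear_combination hdy + hy0 + hlin2 + hY + heY + δ * (R.κ₂ * hD6 + R.κ₁ * hC6)

end PlanarModel

end

/-! ### The forced harmonic oscillator -/

noncomputable section

open Real (smoothTransition)

theorem contDiff_primitive {f : ℝ → ℝ} (hf : ContDiff ℝ ∞ f) :
    ContDiff ℝ ∞ fun t => ∫ τ in (0 : ℝ)..t, f τ := by
  refine contDiff_infty_iff_deriv.2
    ⟨fun t => (hasDerivAt_primitive hf.continuous t).differentiableAt, ?_⟩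
  rwa [funext fun t => (hasDerivAt_primitive hf.continuous t).deriv]

theorem integral_eq_zero_of_eq_zero {f : ℝ → ℝ} (hf : ∀ t ≤ 1, f t = 0) {t : ℝ} (ht : t ≤ 1) :
    ∫ τ in (0 : ℝ)..t, f τ = 0 := by
  have h : EqOn f (fun _ => 0) (uIcc 0 t) := fun τ hτ =>
    hf τ (hτ.2.trans (max_le zero_le_one ht))
  rw [intervalIntegral.integral_congr h, intervalIntegral.integral_zero]

/-- The response of a harmonic oscillator, initially at rest, to an external force. -/
theorem exists_oscillator_response (σ c : ℝ) {h : ℝ → ℝ} (hh : ContDiff ℝ ∞ h)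
    (h0 : ∀ t ≤ 1, h t = 0) : ∃ F G : ℝ → ℝ, ContDiff ℝ ∞ F ∧ ContDiff ℝ ∞ G ∧
      (∀ t, HasDerivAt F (G t) t) ∧ (∀ t, HasDerivAt G (σ ^ 2 * (c * h t - F t)) t) ∧
      ∀ t ≤ 1, F t = 0 ∧ G t = 0 := by
  have hcs : ContDiff ℝ ∞ fun t => Real.cos (σ * t) * h t := by fun_prop
  have hss : ContDiff ℝ ∞ fun t => Real.sin (σ * t) * h t := by fun_prop
  set C : ℝ → ℝ := fun t => ∫ τ in (0 : ℝ)..t, Real.cos (σ * τ) * h τ with hC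
  set D : ℝ → ℝ := fun t => ∫ τ in (0 : ℝ)..t, Real.sin (σ * τ) * h τ with hD
  have hCs : ContDiff ℝ ∞ C := contDiff_primitive hcs
  have hDs : ContDiff ℝ ∞ D := contDiff_primitive hss
  have hCd : ∀ t, HasDerivAt C (Real.cos (σ * t) * h t) t := hasDerivAt_primitive hcs.continuous
  have hDd : ∀ t, HasDerivAt D (Real.sin (σ * t) * h t) t := hasDerivAt_primitive hss.continuous
  have hl : ∀ t : ℝ, HasDerivAt (fun t => σ * t) σ t := fun t =>
    ((hasDerivAt_id t).const_mul σ).congr_deriv (mul_one σ)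
  -- Variation of constants: `F` is `σ c` times the integral of `sin (σ (t - τ)) h τ`.
  refine ⟨fun t => σ * c * (Real.sin (σ * t) * C t - Real.cos (σ * t) * D t),
    fun t => σ ^ 2 * c * (Real.cos (σ * t) * C t + Real.sin (σ * t) * D t),
    by fun_prop, by fun_prop, fun t => ?_, fun t => ?_, fun t ht => ?_⟩
  · refine ((((hl t).sin.mul (hCd t)).sub ((hl t).cos.mul (hDd t))).const_mul _).congr_deriv ?_
    ring
  · refine ((((hl t).cos.mul (hCd t)).add ((hl t).sin.mul (hDd t))).const_mul _).congr_deriv ?_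
    linear_combination (σ ^ 2 * c * h t) * Real.sin_sq_add_cos_sq (σ * t)
  · have e1 : C t = 0 := integral_eq_zero_of_eq_zero (fun τ hτ => by simp [h0 τ hτ]) ht
    have e2 : D t = 0 := integral_eq_zero_of_eq_zero (fun τ hτ => by simp [h0 τ hτ]) ht
    simp [e1, e2]

/-- A harmonic oscillator at rest is brought to any state of a given bounded set by a small force,
if there is enough time. -/
theorem exists_oscillator_control {σ c E : ℝ} (hσ : σ ≠ 0) (hc : 0 < c) (hE : 0 ≤ E) :
    ∃ L : ℝ, 0 < L ∧ ∀ a b : ℝ, |a| ≤ E → |b| ≤ E → ∃ f g w : ℝ → ℝ,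
      ContDiff ℝ ∞ f ∧ ContDiff ℝ ∞ g ∧ ContDiff ℝ ∞ w ∧
      (∀ t, HasDerivAt f (g t) t) ∧ (∀ t, HasDerivAt g (σ ^ 2 * (c * w t - f t)) t) ∧
      (∀ t ≤ 1, f t = 0 ∧ g t = 0 ∧ w t = 0) ∧ (∀ t, 1 + L ≤ t → w t = 0) ∧
      (∀ t, |w t| ≤ 1 / 2) ∧ f (L + 2) = a ∧ g (L + 2) = b := by
  obtain ⟨C, hC0, hC1, hC2⟩ := exists_bound_deriv_smoothTransition
  have hσ' : 0 < |σ| := abs_pos.2 hσ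
  have hσ2 : 0 < σ ^ 2 * c := by positivity
  set Q := C * (E + E / |σ|) + 2 * C * (E * |σ| + E) with hQ
  have hQ0 : 0 ≤ Q := by positivity
  -- The force found below is at most `Q / (L * σ ^ 2 * c)` in absolute value; this `L` makes it at
  -- most `1 / 2`.
  set L := 1 + 2 * Q / (σ ^ 2 * c) with hL
  have hL1 : 1 ≤ L := le_add_of_nonneg_right (by positivity)
  have hL0 : 0 < L := by linarith
  refine ⟨L, hL0, fun a b ha hb => ?_⟩
  -- The free oscillation through `(a, b)` at time `L + 2`. Switching it on by a step `S` stretched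
  -- over length `L` needs only a force of order `1 / L`. The force ends at `1 + L`, leaving the
  -- last unit of time for the final move of the particle.
  set G : ℝ → ℝ := fun t => a * Real.cos (σ * (t - (L + 2))) + b / σ * Real.sin (σ * (t - (L + 2)))
    with hG
  set G' : ℝ → ℝ := fun t => b * Real.cos (σ * (t - (L + 2)))
    - a * σ * Real.sin (σ * (t - (L + 2))) with hG'
  have hl : ∀ t : ℝ, HasDerivAt (fun t => σ * (t - (L + 2))) σ t := fun t =>
    (((hasDerivAt_id t).sub_const _).const_mul σ).congr_deriv (mul_one σ)
  have hGd : ∀ t, HasDerivAt G (G' t) t := fun t =>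
    (((hl t).cos.const_mul a).add ((hl t).sin.const_mul (b / σ))).congr_deriv (by
      simp only [hG']; field_simp; ring)
  have hGd' : ∀ t, HasDerivAt G' (-σ ^ 2 * G t) t := fun t =>
    (((hl t).cos.const_mul b).sub ((hl t).sin.const_mul (a * σ))).congr_deriv (by
      simp only [hG]; field_simp; ring)
  have hGs : ContDiff ℝ ∞ G := by fun_prop
  have hGs' : ContDiff ℝ ∞ G' := by fun_prop
  have hm : ∀ t : ℝ, HasDerivAt (fun t => (t - 1) / L) (1 / L) t := fun t =>
    ((hasDerivAt_id t).sub_const 1).div_const L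
  set S : ℝ → ℝ := fun t => smoothTransition ((t - 1) / L) with hS
  set S₁ : ℝ → ℝ := fun t => deriv smoothTransition ((t - 1) / L) / L with hS₁
  set S₂ : ℝ → ℝ := fun t => deriv (deriv smoothTransition) ((t - 1) / L) / L ^ 2 with hS₂
  have hlin : ContDiff ℝ ∞ fun t : ℝ => (t - 1) / L := by fun_prop
  have hSs : ContDiff ℝ ∞ S := contDiff_smoothTransition.comp hlin
  have hS₁s : ContDiff ℝ ∞ S₁ :=
    ((PlanarModel.contDiff_deriv contDiff_smoothTransition).comp hlin).div_const L
  have hS₂s : ContDiff ℝ ∞ S₂ := ((PlanarModel.contDiff_deriv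
    (PlanarModel.contDiff_deriv contDiff_smoothTransition)).comp hlin).div_const (L ^ 2)
  have hSd : ∀ t, HasDerivAt S (S₁ t) t := fun t =>
    ((hasDerivAt_smoothTransition _).comp t (hm t)).congr_deriv (by simp only [hS₁]; ring)
  have hS₁d : ∀ t, HasDerivAt S₁ (S₂ t) t := fun t =>
    (((hasDerivAt_deriv_smoothTransition _).comp t (hm t)).div_const L).congr_deriv (by
      simp only [hS₂]; field_simp)
  have hneg : ∀ t : ℝ, t ≤ 1 → (t - 1) / L ≤ 0 := fun t ht =>
    div_nonpos_of_nonpos_of_nonneg (by linarith) hL0.le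
  have hone : ∀ t : ℝ, 1 + L ≤ t → 1 ≤ (t - 1) / L := fun t ht => by
    rw [le_div_iff₀ hL0]; linarith
  have hfin : S (L + 2) = 1 ∧ S₁ (L + 2) = 0 := by
    have := hone (L + 2) (by linarith)
    exact ⟨Real.smoothTransition.one_of_one_le this, by
      simp only [hS₁, deriv_smoothTransition_of_one_le this, zero_div]⟩
  refine ⟨fun t => S t * G t, fun t => S₁ t * G t + S t * G' t,
    fun t => (S₂ t * G t + 2 * S₁ t * G' t) / (σ ^ 2 * c), by fun_prop, by fun_prop, by fun_prop,
    fun t => (hSd t).mul (hGd t), fun t => ?_, fun t ht => ?_, fun t ht => ?_, fun t => ?_, ?_, ?_⟩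
  · refine (((hS₁d t).mul (hGd t)).add ((hSd t).mul (hGd' t))).congr_deriv ?_
    field_simp
    ring
  · simp [hS, hS₁, hS₂, Real.smoothTransition.zero_of_nonpos (hneg t ht),
      deriv_smoothTransition_of_nonpos (hneg t ht),
      deriv_deriv_smoothTransition_of_nonpos (hneg t ht)]
  · simp [hS₁, hS₂, deriv_smoothTransition_of_one_le (hone t ht),
      deriv_deriv_smoothTransition_of_one_le (hone t ht)]
  · have hGb : |G t| ≤ E + E / |σ| := by
      refine (abs_add_le _ _).trans (add_le_add ?_ ?_)
      · rw [abs_mul]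
        exact (mul_le_of_le_one_right (abs_nonneg _) (Real.abs_cos_le_one _)).trans ha
      · rw [abs_mul, abs_div]
        refine (mul_le_of_le_one_right (by positivity) (Real.abs_sin_le_one _)).trans ?_
        gcongr
    have hGb' : |G' t| ≤ E * |σ| + E := by
      refine (abs_sub _ _).trans ?_
      rw [add_comm]
      refine add_le_add ?_ ?_
      · rw [abs_mul, abs_mul]
        refine (mul_le_of_le_one_right (by positivity) (Real.abs_sin_le_one _)).trans ?_
        gcongr
      · rw [abs_mul]
        exact (mul_le_of_le_one_right (abs_nonneg _) (Real.abs_cos_le_one _)).trans hb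
    have hS₁b : |S₁ t| ≤ C / L := by
      simp only [hS₁]
      rw [abs_div, abs_of_pos hL0]
      gcongr
      exact hC1 _
    have hS₂b : |S₂ t| ≤ C / L := by
      simp only [hS₂]
      rw [abs_div, abs_of_pos (by positivity : 0 < L ^ 2)]
      refine (div_le_div_of_nonneg_right (hC2 _) (by positivity)).trans ?_
      exact div_le_div_of_nonneg_left hC0 hL0 (by nlinarith)
    rw [abs_div, abs_of_pos hσ2, div_le_iff₀ hσ2]
    calc |S₂ t * G t + 2 * S₁ t * G' t| ≤ |S₂ t| * |G t| + 2 * |S₁ t| * |G' t| := by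
          refine (abs_add_le _ _).trans (le_of_eq ?_)
          rw [abs_mul, abs_mul, abs_mul, abs_two]
      _ ≤ C / L * (E + E / |σ|) + 2 * (C / L) * (E * |σ| + E) := by gcongr
      _ = Q / L := by simp only [hQ]; ring
      _ ≤ 1 / 2 * (σ ^ 2 * c) := by
          rw [div_le_iff₀ hL0, hL]
          have : 2 * Q / (σ ^ 2 * c) * (σ ^ 2 * c) = 2 * Q := div_mul_cancel₀ _ hσ2.ne'
          nlinarith
  · simp [hfin.1, hG]
  · simp [hfin.1, hfin.2, hG']

/-! ### Translational motion at a fixed angle, with circulation -/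

namespace PlanarModel

variable {R : PlanarModel} {θ u x y : ℝ → ℝ}

/-- If body and particle do not turn or move any more, the momentum remains bounded. -/
theorem IsPath.exists_bound_momentum (h : R.IsPath θ u x y) (ha₁ : 0 < R.a₁) (ha₂ : 0 < R.a₂)
    (hθ : Differentiable ℝ θ) (hθ' : ∀ t, 1 ≤ t → deriv θ t = 0) (hu : ∀ t, 1 ≤ t → u t = 0)
    (hu' : ∀ t, 1 ≤ t → deriv u t = 0) : ∃ E : ℝ, ∀ t, 1 ≤ t →
      |R.p₁ (θ t) (x t) (y t)| ≤ E ∧ |R.p₂ (θ t) (x t) (y t)| ≤ E := by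
  -- Twice the translational kinetic energy: the circulation force is orthogonal to the velocity and
  -- does no work.
  set e : ℝ → ℝ := fun t => R.p₁ (θ t) (x t) (y t) ^ 2 / R.a₁ + R.p₂ (θ t) (x t) (y t) ^ 2 / R.a₂
    with he
  have hconst : ∀ t, 1 ≤ t → e t = e 1 := by
    intro t ht
    have hd : ∀ τ ∈ Ici (1 : ℝ), HasDerivWithinAt e 0 (Ici 1) τ := by
      intro τ hτ
      have h1 := h.hasDerivAt_p₁ (hθ τ).hasDerivAt
      have h2 := h.hasDerivAt_p₂ (hθ τ).hasDerivAt
      refine ((((h1.pow 2).div_const R.a₁).add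
        ((h2.pow 2).div_const R.a₂)).congr_deriv ?_).hasDerivWithinAt
      simp only [v₁, v₂, hθ' τ hτ, hu τ hτ, hu' τ hτ]
      push_cast
      ring
    have := (convex_Ici (1 : ℝ)).norm_image_sub_le_of_norm_hasDerivWithin_le (C := 0) hd
      (fun _ _ => by simp) (mem_Ici.2 le_rfl) (mem_Ici.2 ht)
    rw [zero_mul, norm_le_zero_iff, sub_eq_zero] at this
    exact this
  have hsq : ∀ p q : ℝ, p ^ 2 ≤ q → |p| ≤ 1 + q := by
    intro p q h
    rw [abs_le]
    constructor <;> nlinarith [sq_nonneg (p - 1), sq_nonneg (p + 1)]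
  have he0 : 0 ≤ e 1 := by positivity
  refine ⟨1 + (R.a₁ + R.a₂) * e 1, fun t ht => ⟨hsq _ _ ?_, hsq _ _ ?_⟩⟩
  · have h1 : R.p₁ (θ t) (x t) (y t) ^ 2 / R.a₁ ≤ e 1 := by
      rw [← hconst t ht]; exact le_add_of_nonneg_right (by positivity)
    rw [div_le_iff₀ ha₁] at h1
    nlinarith
  · have h1 : R.p₂ (θ t) (x t) (y t) ^ 2 / R.a₂ ≤ e 1 := by
      rw [← hconst t ht]; exact le_add_of_nonneg_left (by positivity)
    rw [div_le_iff₀ ha₂] at h1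
    nlinarith

/-- Superposition of a path and the motion caused by an additional displacement `w` of the particle
at a time when the body does not turn any more. The latter is written in terms of a solution
`f` of an oscillator equation. -/
theorem IsPath.superpose (h : R.IsPath θ u x y) (ha₁ : 0 < R.a₁) (ha₂ : 0 < R.a₂)
    (hl : R.lam ≠ 0) {c θ₁ : ℝ} (hc0 : 0 < c)
    (hθ : ∀ t, 1 ≤ t → θ t = θ₁) (hθ' : ∀ t, 1 ≤ t → deriv θ t = 0) (hu : Differentiable ℝ u)
    {f g w : ℝ → ℝ} (hw : Differentiable ℝ w) (hf : ∀ t, HasDerivAt f (g t) t)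
    (hg : ∀ t, HasDerivAt g (R.lam ^ 2 / (R.a₁ * R.a₂) * (c * w t - f t)) t)
    (h0 : ∀ t ≤ 1, f t = 0 ∧ g t = 0 ∧ w t = 0) {X Y : ℝ → ℝ}
    (hX : X = fun t => (R.κ₁ * f t / R.a₁ + R.κ₂ * g t / R.lam) / c - R.κ₁ * w t / R.a₁)
    (hY : Y = fun t => (R.κ₂ * f t / R.a₂ - R.κ₁ * g t / R.lam) / c - R.κ₂ * w t / R.a₂) :
    R.IsPath θ (fun t => u t + w t) (fun t => x t + (X t * Real.cos θ₁ - Y t * Real.sin θ₁))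
      (fun t => y t + (X t * Real.sin θ₁ + Y t * Real.cos θ₁)) := by
  have hwd := fun t => (hw t).hasDerivAt
  -- In the frame turned by `θ₁`, the additional displacement `(X, Y)` obeys the homogeneous linear
  -- part of the equations, forced by `deriv w`.
  have hXd : ∀ t, HasDerivAt X (-(R.lam * Y t + R.κ₁ * deriv w t) / R.a₁) t := by
    intro t
    rw [hX]
    refine ((((((hf t).const_mul R.κ₁).div_const R.a₁).add
      (((hg t).const_mul R.κ₂).div_const R.lam)).div_const c).sub
      (((hwd t).const_mul R.κ₁).div_const R.a₁)).congr_deriv ?_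
    simp only [hY]
    field_simp
    ring
  have hYd : ∀ t, HasDerivAt Y ((R.lam * X t - R.κ₂ * deriv w t) / R.a₂) t := by
    intro t
    rw [hY]
    refine ((((((hf t).const_mul R.κ₂).div_const R.a₂).sub
      (((hg t).const_mul R.κ₁).div_const R.lam)).div_const c).sub
      (((hwd t).const_mul R.κ₂).div_const R.a₂)).congr_deriv ?_
    simp only [hX]
    field_simp
    ring
  have hud : ∀ t, deriv (fun t => u t + w t) t = deriv u t + deriv w t := fun t =>
    deriv_add (hu t) (hw t)
  -- Before time 1 the body may still turn, but then the additional motion vanishes identically.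
  have hsplit : ∀ t, (θ t = θ₁ ∧ deriv θ t = 0) ∨ (X t = 0 ∧ Y t = 0 ∧ w t = 0 ∧ deriv w t = 0) := by
    intro t
    rcases le_or_gt 1 t with ht | ht
    · exact Or.inl ⟨hθ t ht, hθ' t ht⟩
    · right
      obtain ⟨e1, e2, e3⟩ := h0 t ht.le
      refine ⟨by simp [hX, e1, e2, e3], by simp [hY, e1, e2, e3], e3, ?_⟩
      have : w =ᶠ[nhds t] fun _ => 0 := by
        filter_upwards [Iio_mem_nhds ht] with τ hτ
        exact (h0 τ (le_of_lt hτ)).2.2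
      rw [this.deriv_eq, deriv_const]
  refine ⟨fun t => ?_, fun t => ?_⟩
  · refine ((h.deriv_x t).add (((hXd t).mul_const _).sub ((hYd t).mul_const _))).congr_deriv ?_
    simp only [hud, v₁, v₂, p₁, p₂]
    rcases hsplit t with ⟨e1, e2⟩ | ⟨e1, e2, e3, e4⟩
    · rw [e1, e2]
      field_simp
      linear_combination (R.lam * X t * R.a₁ * Real.sin θ₁ + R.lam * Y t * R.a₂ * Real.cos θ₁)
        * Real.sin_sq_add_cos_sq θ₁
    · rw [e1, e2, e3, e4]; ring
  · refine ((h.deriv_y t).add (((hXd t).mul_const _).add ((hYd t).mul_const _))).congr_deriv ?_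
    simp only [hud, v₁, v₂, p₁, p₂]
    rcases hsplit t with ⟨e1, e2⟩ | ⟨e1, e2, e3, e4⟩
    · rw [e1, e2]
      field_simp
      linear_combination (-R.lam * X t * R.a₁ * Real.cos θ₁ + R.lam * Y t * R.a₂ * Real.sin θ₁)
        * Real.sin_sq_add_cos_sq θ₁
    · rw [e1, e2, e3, e4]; ring

end PlanarModel

end

/-! ### Controllability with circulation -/

noncomputable section

open Real (smoothTransition)

namespace PlanarModel

variable {R : PlanarModel}

/-- For `l ≠ 0` the momentum determines the position, so bounded momenta bound the distance to the
target. -/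
theorem abs_le_of_rotated {p₁ p₂ q₁ q₂ l X Y E : ℝ} (hl : l ≠ 0) (h₁ : p₁ = q₁ - l * Y)
    (h₂ : p₂ = q₂ + l * X) (hE : |q₁| ≤ E ∧ |q₂| ≤ E) :
    |X| ≤ (|p₁| + |p₂| + E) / |l| ∧ |Y| ≤ (|p₁| + |p₂| + E) / |l| := by
  have hl' := abs_pos.2 hl
  constructor
  · rw [le_div_iff₀ hl', ← abs_mul, show X * l = p₂ - q₂ by rw [h₂]; ring]
    have := abs_sub p₂ q₂
    linarith [abs_nonneg p₁, hE.2]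
  · rw [le_div_iff₀ hl', ← abs_mul, show Y * l = q₁ - p₁ by rw [h₁]; ring]
    have := abs_sub q₁ p₁
    linarith [abs_nonneg p₂, hE.1]

-- The base path reaches the angle `θ₁` and brings the particle to `0` by time 1. The correction `w`
-- acts on `[1, L + 1]`, and the particle goes to `s₁` on `[L + 1, L + 2]`. The effect `F` of this
-- last move is known beforehand and is subtracted from the target of the oscillator.
set_option maxHeartbeats 1600000 in
theorem controllable_of_lam_ne_zero (ha₁ : 0 < R.a₁) (ha₂ : 0 < R.a₂)
    (hκ : R.κ₁ ≠ 0 ∨ R.κ₂ ≠ 0) (hl : R.lam ≠ 0) : R.Controllable := by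
  intro x₀ y₀ θ₀ ω₀ s₀ ds₀ x₁ y₁ θ₁ s₁
  set sA := approach s₀ ds₀ 0 with hsA
  set θ := approach θ₀ ω₀ θ₁ with hθ
  have hsAs : ContDiff ℝ ∞ sA := contDiff_approach _ _ _
  have hθs : ContDiff ℝ ∞ θ := contDiff_approach _ _ _
  have husA : ContDiff ℝ ∞ fun t => Real.sin (sA t) := Real.contDiff_sin.comp hsAs
  obtain ⟨xb, yb, hxb, hyb, hxb0, hyb0, hb⟩ := R.exists_isPath hθs husA x₀ y₀
  have hθ1 : ∀ t, 1 ≤ t → θ t = θ₁ := fun t ht => approach_of_ge ht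
  have hθ1' : ∀ t, 1 ≤ t → deriv θ t = 0 := fun t ht => deriv_approach_of_ge ht
  have hsA1 : ∀ t, 1 ≤ t → sA t = 0 := fun t ht => approach_of_ge ht
  obtain ⟨E, hE⟩ := hb.exists_bound_momentum ha₁ ha₂ (hθs.differentiable (by simp)) hθ1'
    (fun t ht => by simp [hsA1 t ht]) (fun t ht => by
      rw [(hasDerivAt_approach s₀ ds₀ 0 t).sin.deriv, deriv_approach_of_ge ht, mul_zero])
  have hσ0 : 0 < R.lam ^ 2 / (R.a₁ * R.a₂) := by positivity
  obtain ⟨σ, hσne, hσ⟩ : ∃ σ : ℝ, σ ≠ 0 ∧ σ ^ 2 = R.lam ^ 2 / (R.a₁ * R.a₂) :=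
    ⟨√(R.lam ^ 2 / (R.a₁ * R.a₂)), (Real.sqrt_pos.2 hσ0).ne', Real.sq_sqrt hσ0.le⟩
  -- With this `c` the state `(f, g)` is recovered linearly from the displacement; it is positive
  -- because the segment is not degenerate.
  obtain ⟨c, hc0, hc⟩ : ∃ c : ℝ, 0 < c ∧ c = R.κ₁ ^ 2 / R.a₁ + R.κ₂ ^ 2 / R.a₂ :=
    ⟨_, by rcases hκ with h | h <;> positivity, rfl⟩
  set h : ℝ → ℝ := fun t => Real.sin (s₁ * smoothTransition (t - 1)) with hh
  have hhs : ContDiff ℝ ∞ h := by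
    have := contDiff_smoothTransition_sub 1
    fun_prop
  have hh0 : ∀ t ≤ 1, h t = 0 := fun t ht => by
    simp [hh, Real.smoothTransition.zero_of_nonpos (by linarith : t - 1 ≤ 0)]
  obtain ⟨F, F', hFs, hFs', hFd, hFd', hF0⟩ := exists_oscillator_response σ c hhs hh0
  -- None of these bounds may involve `L`, which is chosen from them; conservation of energy makes
  -- this possible through `E`.
  set q := (|R.p₁ θ₁ x₁ y₁| + |R.p₂ θ₁ x₁ y₁| + E) / |R.lam| + |R.κ₁ * Real.sin s₁ / R.a₁|
    + |R.κ₂ * Real.sin s₁ / R.a₂| with hq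
  set E₁ := (|R.κ₁| + |R.κ₂|) * q + |F 2| with hE₁
  set E₂ := |R.lam| * (|R.κ₂ / R.a₂| + |R.κ₁ / R.a₁|) * q + |F' 2| with hE₂
  have hEn : 0 ≤ E := (abs_nonneg _).trans (hE 1 le_rfl).1
  have hqn : 0 ≤ q := by positivity
  have hE₁n : 0 ≤ E₁ := by positivity
  have hE₂n : 0 ≤ E₂ := by positivity
  obtain ⟨L, hL0, hL⟩ := exists_oscillator_control hσne hc0 (add_nonneg hE₁n hE₂n)
  have hT : 1 ≤ L + 2 := by linarith
  set dx := x₁ - xb (L + 2) with hdx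
  set dy := y₁ - yb (L + 2) with hdy
  set X₁ := dx * Real.cos θ₁ + dy * Real.sin θ₁ with hX₁
  set Y₁ := -dx * Real.sin θ₁ + dy * Real.cos θ₁ with hY₁
  obtain ⟨hX₁b, hY₁b⟩ : |X₁| ≤ (|R.p₁ θ₁ x₁ y₁| + |R.p₂ θ₁ x₁ y₁| + E) / |R.lam| ∧
      |Y₁| ≤ (|R.p₁ θ₁ x₁ y₁| + |R.p₂ θ₁ x₁ y₁| + E) / |R.lam| := by
    refine abs_le_of_rotated hl (q₁ := R.p₁ θ₁ (xb (L + 2)) (yb (L + 2)))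
      (q₂ := R.p₂ θ₁ (xb (L + 2)) (yb (L + 2))) ?_ ?_ (hθ1 (L + 2) hT ▸ hE (L + 2) hT)
    · simp only [p₁, hY₁, hdx, hdy]; ring
    · simp only [p₂, hX₁, hdx, hdy]; ring
  -- Compensates the direct term in `w₁` of `X` and `Y`, as `w₁ = sin s₁` at the final time.
  set X₂ := X₁ + R.κ₁ * Real.sin s₁ / R.a₁ with hX₂
  set Y₂ := Y₁ + R.κ₂ * Real.sin s₁ / R.a₂ with hY₂
  have hX₂b : |X₂| ≤ q := by
    have := abs_add_le X₁ (R.κ₁ * Real.sin s₁ / R.a₁)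
    have := abs_nonneg (R.κ₂ * Real.sin s₁ / R.a₂)
    linarith
  have hY₂b : |Y₂| ≤ q := by
    have := abs_add_le Y₁ (R.κ₂ * Real.sin s₁ / R.a₂)
    have := abs_nonneg (R.κ₁ * Real.sin s₁ / R.a₁)
    linarith
  obtain ⟨f, g, w, hfs, hgs, hws, hfd, hgd, hfgw0, hwL, hwb, hfT, hgT⟩ :=
    hL (R.κ₁ * X₂ + R.κ₂ * Y₂ - F 2) (R.lam * (R.κ₂ / R.a₂ * X₂ - R.κ₁ / R.a₁ * Y₂) - F' 2)
    (by
      refine (abs_sub _ _).trans (le_trans ?_ (le_add_of_nonneg_right hE₂n))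
      rw [hE₁, add_mul]
      gcongr
      refine (abs_add_le _ _).trans ?_
      rw [abs_mul, abs_mul]
      gcongr)
    (by
      refine (abs_sub _ _).trans (le_trans ?_ (le_add_of_nonneg_left hE₁n))
      rw [hE₂, mul_assoc, add_mul, abs_mul]
      gcongr
      refine (abs_sub _ _).trans ?_
      rw [abs_mul, abs_mul]
      gcongr)
  set f₁ : ℝ → ℝ := fun t => f t + F (t - L) with hf₁
  set g₁ : ℝ → ℝ := fun t => g t + F' (t - L) with hg₁
  set w₁ : ℝ → ℝ := fun t => w t + h (t - L) with hw₁
  have hf₁s : ContDiff ℝ ∞ f₁ := hfs.add (hFs.comp (contDiff_id.sub contDiff_const))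
  have hg₁s : ContDiff ℝ ∞ g₁ := hgs.add (hFs'.comp (contDiff_id.sub contDiff_const))
  have hw₁s : ContDiff ℝ ∞ w₁ := hws.add (hhs.comp (contDiff_id.sub contDiff_const))
  have hf₁d : ∀ t, HasDerivAt f₁ (g₁ t) t := fun t =>
    (hfd t).add ((hFd (t - L)).comp_sub_const t L)
  have hg₁d : ∀ t, HasDerivAt g₁ (R.lam ^ 2 / (R.a₁ * R.a₂) * (c * w₁ t - f₁ t)) t := fun t =>
    ((hgd t).add ((hFd' (t - L)).comp_sub_const t L)).congr_deriv (by
      rw [← hσ]; simp only [hw₁, hf₁]; ring)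
  have h0 : ∀ t ≤ 1, f₁ t = 0 ∧ g₁ t = 0 ∧ w₁ t = 0 := by
    intro t ht
    obtain ⟨e1, e2, e3⟩ := hfgw0 t ht
    obtain ⟨e4, e5⟩ := hF0 (t - L) (by linarith)
    exact ⟨by simp [hf₁, e1, e4], by simp [hg₁, e2, e5],
      by simp [hw₁, e3, hh0 (t - L) (by linarith)]⟩
  set X : ℝ → ℝ := fun t => (R.κ₁ * f₁ t / R.a₁ + R.κ₂ * g₁ t / R.lam) / c - R.κ₁ * w₁ t / R.a₁
    with hX
  set Y : ℝ → ℝ := fun t => (R.κ₂ * f₁ t / R.a₂ - R.κ₁ * g₁ t / R.lam) / c - R.κ₂ * w₁ t / R.a₂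
    with hY
  have hXs : ContDiff ℝ ∞ X := by fun_prop
  have hYs : ContDiff ℝ ∞ Y := by fun_prop
  have hpath := hb.superpose ha₁ ha₂ hl hc0 hθ1 hθ1' (husA.differentiable (by simp))
    (hw₁s.differentiable (by simp)) hf₁d hg₁d h0 hX hY
  -- The three summands are nonzero only on consecutive time intervals, so that `sin s` is the sum
  -- of their sines.
  set s : ℝ → ℝ := fun t => sA t + Real.arcsin (w t) + s₁ * smoothTransition (t - (L + 1)) with hs
  have hss : ContDiff ℝ ∞ s := by
    have h1 := contDiff_arcsin_comp hws hwb
    have h2 := contDiff_smoothTransition_sub (L + 1)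
    fun_prop
  have hu : (fun t => Real.sin (sA t) + w₁ t) = fun t => Real.sin (s t) := by
    funext t
    rcases le_total t (L + 1) with h1 | h1
    · have e1 : h (t - L) = 0 := hh0 _ (by linarith)
      have e2 := Real.smoothTransition.zero_of_nonpos (by linarith : t - (L + 1) ≤ 0)
      rcases le_total t 1 with h2 | h2
      · simp [hw₁, hs, e1, e2, (hfgw0 t h2).2.2]
      · simp [hw₁, hs, e1, e2, hsA1 t h2, sin_arcsin_of_abs_le (hwb t)]
    · simp [hw₁, hs, hh, hsA1 t (by linarith), hwL t (by linarith), sub_sub]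
  rw [hu] at hpath
  have hsnear : s =ᶠ[nhds 0] fun t => s₀ + ds₀ * t := by
    filter_upwards [Iio_mem_nhds (by norm_num : (0 : ℝ) < 1 / 2)] with t ht
    have ht' : t < 1 / 2 := ht
    simp only [hs, hsA, approach_of_le ht'.le, (hfgw0 t (by linarith)).2.2,
      Real.smoothTransition.zero_of_nonpos (by linarith : t - (L + 1) ≤ 0)]
    simp
  have hs0 : s 0 = s₀ := by simpa using hsnear.eq_of_nhds
  have hsT : s (L + 2) = s₁ := by
    simp only [hs, hsA1 (L + 2) hT, hwL (L + 2) (by linarith),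
      Real.smoothTransition.one_of_one_le (by linarith : 1 ≤ L + 2 - (L + 1))]
    simp
  have hθnear := eventuallyEq_approach θ₀ ω₀ θ₁
  have hf₁T : f₁ (L + 2) = R.κ₁ * X₂ + R.κ₂ * Y₂ := by
    simp [hf₁, hfT]
  have hg₁T : g₁ (L + 2) = R.lam * (R.κ₂ / R.a₂ * X₂ - R.κ₁ / R.a₁ * Y₂) := by
    simp [hg₁, hgT]
  have hw₁T : w₁ (L + 2) = Real.sin s₁ := by
    simp only [hw₁, hh, hwL (L + 2) (by linarith), add_sub_cancel_left,
      Real.smoothTransition.one_of_one_le (by norm_num : (1 : ℝ) ≤ 2 - 1)]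
    simp
  have hXT : X (L + 2) = X₁ := by
    simp only [hX, hf₁T, hg₁T, hw₁T]
    have : (R.κ₁ * (R.κ₁ * X₂ + R.κ₂ * Y₂) / R.a₁
        + R.κ₂ * (R.lam * (R.κ₂ / R.a₂ * X₂ - R.κ₁ / R.a₁ * Y₂)) / R.lam) = c * X₂ := by
      rw [hc]; field_simp; ring
    rw [this, mul_div_cancel_left₀ _ hc0.ne', hX₂]; ring
  have hYT : Y (L + 2) = Y₁ := by
    simp only [hY, hf₁T, hg₁T, hw₁T]
    have : (R.κ₂ * (R.κ₁ * X₂ + R.κ₂ * Y₂) / R.a₂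
        - R.κ₁ * (R.lam * (R.κ₂ / R.a₂ * X₂ - R.κ₁ / R.a₁ * Y₂)) / R.lam) = c * Y₂ := by
      rw [hc]; field_simp; ring
    rw [this, mul_div_cancel_left₀ _ hc0.ne', hY₂]; ring
  have hX0 : X 0 = 0 ∧ Y 0 = 0 := by
    obtain ⟨e1, e2, e3⟩ := h0 0 zero_le_one
    simp [hX, hY, e1, e2, e3]
  refine ⟨L + 2, by linarith, s, θ, _, _, hss, hθs, by fun_prop, by fun_prop, hs0,
    deriv_zero_of_eventuallyEq hsnear, hsT, by simpa using hθnear.eq_of_nhds,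
    deriv_zero_of_eventuallyEq hθnear, hθ1 _ hT, hpath, ?_, ?_, ?_, ?_⟩
  · simp [hX0, hxb0]
  · simp [hX0, hyb0]
  · simp only [hXT, hYT]
    linear_combination (x₁ - xb (L + 2)) * Real.sin_sq_add_cos_sq θ₁
  · simp only [hXT, hYT]
    linear_combination (y₁ - yb (L + 2)) * Real.sin_sq_add_cos_sq θ₁

end PlanarModel

end

/-! ### The theorem -/

theorem theorem2 (B : FluidBody) (k₁ k₂ : ℝ) (hk : k₁ ≠ 0 ∨ k₂ ≠ 0)
    -- initial position, initial velocity, initial state of the particle and of the rotor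
    (x₀ y₀ α₀ v₁₀ v₂₀ ω₀ s₀ ds₀ Ω₀ : ℝ)
    -- final position of the body and of the particle
    (x₁ y₁ α₁ s₁ : ℝ) :
    ∃ T : ℝ, 0 < T ∧
    ∃ s Ω : ℝ → ℝ,
      ContDiff ℝ ((⊤ : ℕ∞) : WithTop ℕ∞) s ∧ ContDiff ℝ ((⊤ : ℕ∞) : WithTop ℕ∞) Ω ∧
      s 0 = s₀ ∧ deriv s 0 = ds₀ ∧ Ω 0 = Ω₀ ∧ s T = s₁ ∧
      ∃ x y α v₁ v₂ ω : ℝ → ℝ,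
        B.IsMotion T (fun t => k₁ * Real.sin (s t)) (fun t => k₂ * Real.sin (s t)) Ω
          x y α v₁ v₂ ω ∧
        x 0 = x₀ ∧ y 0 = y₀ ∧ α 0 = α₀ ∧
        v₁ 0 = v₁₀ ∧ v₂ 0 = v₂₀ ∧ ω 0 = ω₀ ∧
        x T = x₁ ∧ y T = y₁ ∧ α T = α₁ := by
  -- The initial velocity is built into the model through `K₁`, `K₂`; `Real.cos s₀ * ds₀` is the
  -- initial rate of `sin s`.
  obtain ⟨K₁, K₂, hK₁, hK₂⟩ := B.exists_momentum_constants k₁ k₂ α₀ ω₀ (Real.sin s₀)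
    (Real.cos s₀ * ds₀) x₀ y₀ v₁₀ v₂₀
  have ha₁ := B.planarModel_a₁_pos k₁ k₂ K₁ K₂
  have ha₂ := B.planarModel_a₂_pos k₁ k₂ K₁ K₂
  have hκ : (B.planarModel k₁ k₂ K₁ K₂).κ₁ ≠ 0 ∨ (B.planarModel k₁ k₂ K₁ K₂).κ₂ ≠ 0 :=
    hk.imp (mul_ne_zero B.m_pos.ne') (mul_ne_zero B.m_pos.ne')
  have hcontr : (B.planarModel k₁ k₂ K₁ K₂).Controllable := by
    -- If `lam = ρ Γ` vanishes, so do its multiples `ζ` and `χ`.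
    by_cases hl : (B.planarModel k₁ k₂ K₁ K₂).lam = 0
    · have hl' : B.ρ * B.Γ = 0 := hl
      refine PlanarModel.controllable_of_lam_eq_zero ?_ hκ hl ?_ ?_
      · simpa [FluidBody.planarModel] using B.lam_ne
      · simp [FluidBody.planarModel, FluidBody.χ, hl']
      · simp [FluidBody.planarModel, FluidBody.ζ, hl']
    · exact PlanarModel.controllable_of_lam_ne_zero ha₁ ha₂ hκ hl
  obtain ⟨T, hT, s, α, x, y, hs, hα, hx, hy, hs0, hds0, hsT, hα0, hω0, hαT, hpath, hx0, hy0, hxT,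
    hyT⟩ := hcontr x₀ y₀ α₀ ω₀ s₀ ds₀ x₁ y₁ α₁ s₁
  obtain ⟨Ω, hΩ, hΩ0, hmotion⟩ := B.exists_isMotion hs hα hx hy hpath T Ω₀
  have hw0 : deriv (fun τ => Real.sin (s τ)) 0 = Real.cos s₀ * ds₀ := by
    rw [((hs.differentiable (by simp)) 0).hasDerivAt.sin.deriv, hs0, hds0]
  refine ⟨T, hT, s, Ω, hs, hΩ, hs0, hds0, hΩ0, hsT, x, y, α, _, _, _, hmotion, hx0, hy0, hα0, ?_, ?_,
    hω0, hxT, hyT, hαT⟩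
  · simp only [hw0, hs0, hα0, hω0, hx0, hy0, hK₁]
  · simp only [hw0, hs0, hα0, hω0, hx0, hy0, hK₂]
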